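/- **Setting.** Let $d\ge 1$, let $\mathcal O\subset\mathbb R^d$ be a bounded polygonal domain (a non-empty connected open set which is the interior of a finite union of compact convex polytopes), let $p\in(1,\infty)$, $p'=p/(p-1)$, $\kappa\ge 0$, and $S(A)=(\kappa+|A|^2)^{(p-2)/2}A$ for $A\in\mathbb R^{d\times d}$ (Frobenius norm). Let $g\in\mathbb W^{2,\infty}_{\mathrm{div}}(\mathcal O)$ and $\sigma\in\mathbb W^{1,\infty}_{\mathrm{div}}(\mathcal O)$, where $\mathbb W^{k,q}_{\mathrm{div}}(\mathcal O)$ is the closure in $W^{k,q}(\mathcal O)$ of the vector fields that are smooth and divergence-free in $\mathcal O$; $\varepsilon g$ is the symmetric gradient of $g$. Let $\mathbb L^2(\mathcal O)$ be the space of square integrable vector fields with its Borel $\sigma$-algebra, and $(\cdot,\cdot)$ the $L^2(\mathcal O)$ pairing. Let $W$ be a real $(\mathcal F_t)_{t\ge0}$-Wiener process on a filtered probability space $(\Omega,\mathcal F,(\mathcal F_t),\mathbb P)$. **Gradient discretisation.** Let $X_{\mathcal D,0}$, $Y_{\mathcal D}$ be finite dimensional real vector spaces with linear maps $\nabla_{\mathcal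 D},\varepsilon_{\mathcal D}:X_{\mathcal D,0}\to L^p(\mathcal O)^{d\times d}$, $\operatorname{div}_{\mathcal D}:X_{\mathcal D,0}\to L^p(\mathcal O)$, $\Pi_{\mathcal D}:X_{\mathcal D,0}\to \mathbb L^2(\mathcal O)$, $\chi_{\mathcal D}:Y_{\mathcal D}\to L^{p\wedge p'}(\mathcal O)$. Put $Y_{\mathcal D,0}=\{q\in Y_{\mathcal D}:\int_{\mathcal O}\chi_{\mathcal D}q\,dx=0\}$ and $E_{\mathcal D,0}=\{v\in X_{\mathcal D,0}: (\chi_{\mathcal D}q,\operatorname{div}_{\mathcal D}v)=0\ \forall q\in Y_{\mathcal D,0}\}$. Assume that $\|\varepsilon_{\mathcal D}\cdot\|_{L^p}$ is a norm on $X_{\mathcal D,0}$, $\|\chi_{\mathcal D}\cdot\|_{L^{p\wedge p'}}$ is a norm on $Y_{\mathcal D,0}$, and $\Pi_{\mathcal D}$ is one-to-one on $E_{\mathcal D,0}$. Let $\mathcal K_{\mathcal D}:\mathbb L^2(\mathcal O)\to E_{\mathcal D,0}$ be given by $(u-\Pi_{\mathcal D}\mathcal K_{\mathcal D}u,\Pi_{\mathcal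 D}\xi)=0$ for all $\xi\in E_{\mathcal D,0}$. Assume that $\mathcal D$ is $\Gamma$-stable for some $\Gamma\in[1,\infty)$: $\varepsilon_{\mathcal D}v\in L^{p'}$ for all $v\in X_{\mathcal D,0}$, and $C_{\mathcal D}(p)+C_{\mathcal D}(p')\le\Gamma$, $\beta_{\mathcal D}(p)\ge\Gamma^{-1}$, $C^{\mathrm{Sob}}_{\mathcal D}(p)+C^{\mathrm{Sob}}_{\mathcal D}(p')\le\Gamma$, where $$C_{\mathcal D}(r)=\sup_{v\in X_{\mathcal D,0}}\frac{\|\Pi_{\mathcal D}v\|_{L^r}+\|\operatorname{div}_{\mathcal D}v\|_{L^r}+\|\nabla_{\mathcal D}v\|_{L^r}}{\|\varepsilon_{\mathcal D}v\|_{L^r}},\qquad C^{\mathrm{Sob}}_{\mathcal D}(r)=\sup_{z\in W^{1,r}(\mathcal O)^d\cap\mathbb L^2(\mathcal O)}\frac{\|\varepsilon_{\mathcal D}\mathcal K_{\mathcal D}z\|_{L^r}}{\|z\|_{W^{1,r}}},$$ $$\beta_{\mathcal D}(p)=\inf_{q\in Y_{\mathcal D,0}}\sup_{v\in X_{\mathcal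 D,0}}\frac{(\chi_{\mathcal D}q,\operatorname{div}_{\mathcal D}v)}{\|\chi_{\mathcal D}q\|_{L^{p\wedge p'}}(\|\varepsilon_{\mathcal D}v\|_{L^p}+\|\varepsilon_{\mathcal D}v\|_{L^{p'}})},$$ all quotients being taken over non-zero elements. **Algorithm.** Let $\tau>0$, $t_n=n\tau$, $\Delta_{n+1}W=W(t_{n+1})-W(t_n)$ and $v^{\mathrm{in}}\in\mathbb L^2(\mathcal O)$. Let $(v^0,\pi^0)\in X_{\mathcal D,0}\times Y_{\mathcal D,0}$ be the solution of $$(\Pi_{\mathcal D}v^0,\Pi_{\mathcal D}\xi)+(\chi_{\mathcal D}\pi^0,\operatorname{div}_{\mathcal D}\xi)=(v^{\mathrm{in}},\Pi_{\mathcal D}\xi),\qquad(\operatorname{div}_{\mathcal D}v^0,\chi_{\mathcal D}q)=0\qquad\forall(\xi,q)\in X_{\mathcal D,0}\times Y_{\mathcal D,0},$$ and recursively let $(v^{n+1},\pi^{n+1})\in X_{\mathcal D,0}\times Y_{\mathcal D,0}$ be the (pathwise) solution of, with $v^{n+1/2}=\tfrac12(v^{n+1}+v^n)$ and for all $(\xi,q)\in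 X_{\mathcal D,0}\times Y_{\mathcal D,0}$, $$(\Pi_{\mathcal D}v^{n+1}-\Pi_{\mathcal D}v^n,\Pi_{\mathcal D}\xi)+\tau\big(S(\varepsilon_{\mathcal D}v^{n+1/2}+\varepsilon g),\varepsilon_{\mathcal D}\xi\big)-(\chi_{\mathcal D}\pi^{n+1}-\chi_{\mathcal D}\pi^n,\operatorname{div}_{\mathcal D}\xi)=\big[B^\sigma_{\mathcal D}(v^{n+1/2},\xi)+((\sigma\cdot\nabla)g,\Pi_{\mathcal D}\xi)\big]\Delta_{n+1}W,$$ $$(\operatorname{div}_{\mathcal D}v^{n+1/2},\chi_{\mathcal D}q)=0,\qquad B^\sigma_{\mathcal D}(v,\xi)=\tfrac12(\sigma^T\nabla_{\mathcal D}v,\Pi_{\mathcal D}\xi)-\tfrac12(\Pi_{\mathcal D}v,\sigma^T\nabla_{\mathcal D}\xi).$$ For $N\ge1$ and Borel sets $A\subset\mathbb L^2(\mathcal O)$ put $$\mu^{1/2,N}_{\tau,\mathcal D}(v^{\mathrm{in}};A)=\frac1N\sum_{n=0}^{N-1}\mathbb P\big(\Pi_{\mathcal D}v^{n+1/2}\in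 A\big).$$ **Claim.** The $\mu^{1/2,N}_{\tau,\mathcal D}(v^{\mathrm{in}};\cdot)$, $N\ge1$, are probability measures on $\mathbb L^2(\mathcal O)$ and form a tight family. Moreover, there are a subsequence $N_1<N_2<\cdots$ and a probability measure $\mu^{1/2}_{\tau,\mathcal D}(v^{\mathrm{in}};\cdot)$ on $\mathbb L^2(\mathcal O)$ such that for every bounded continuous $f:\mathbb L^2(\mathcal O)\to\mathbb R$ $$\int_{\mathbb L^2(\mathcal O)}f(v)\,\mu^{1/2,N_k}_{\tau,\mathcal D}(v^{\mathrm{in}};dv)\xrightarrow[k\to\infty]{}\int_{\mathbb L^2(\mathcal O)}f(v)\,\mu^{1/2}_{\tau,\mathcal D}(v^{\mathrm{in}};dv).$$ -/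

import Mathlib

open MeasureTheory ProbabilityTheory Filter Topology
open scoped ENNReal NNReal BoundedContinuousFunction

noncomputable section

namespace GenStokes

/-- The physical space `ℝ^d`; it is also the value space of vector fields. -/
abbrev Space (d : ℕ) : Type := EuclideanSpace ℝ (Fin d)

/-- Real `d × d` matrices with the inner product `A : B` (so the norm is the Frobenius norm). The
entry with row `j` and column `i` of `A` is `A (j, i)`. -/
abbrev Mat (d : ℕ) : Type := EuclideanSpace ℝ (Fin d × Fin d)

/-- A bounded polygonal (polyhedral) domain: a non-empty connected open set that is the interior
of a finite union of compact convex polytopes. -/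
structure IsPolygonalDomain {d : ℕ} (O : Set (Space d)) : Prop where
  connected : IsConnected O
  polygonal : ∃ T : Finset (Finset (Space d)),
    O = interior (⋃ t ∈ T, convexHull ℝ (t : Set (Space d)))

/-! ### Sobolev spaces on an open set -/

/-- `G` is the weak gradient of `u` on the open set `O`: `G (j, i) = ∂_j u_i`, tested against
smooth functions with compact support in `O`. -/
structure IsWeakGrad {d : ℕ} {ι : Type} [Fintype ι] (O : Set (Space d))
    (u : Space d → EuclideanSpace ℝ ι) (G : Space d → EuclideanSpace ℝ (Fin d × ι)) : Prop where
  locallyIntegrable : LocallyIntegrableOn u O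
  locallyIntegrable_grad : LocallyIntegrableOn G O
  integral_eq : ∀ φ : Space d → ℝ, ContDiff ℝ ((⊤ : ℕ∞) : WithTop ℕ∞) φ →
    HasCompactSupport φ → tsupport φ ⊆ O →
    ∀ (j : Fin d) (i : ι),
      ∫ x in O, fderiv ℝ φ x (EuclideanSpace.single j 1) * u x i = - ∫ x in O, φ x * G x (j, i)

/-- The weak gradient of `u` on `O` (determined up to a null set of `O` if it exists, and
meaningless otherwise). -/
def weakGrad {d : ℕ} {ι : Type} [Fintype ι] (O : Set (Space d))
    (u : Space d → EuclideanSpace ℝ ι) : Space d → EuclideanSpace ℝ (Fin d × ι) :=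
  Classical.epsilon (IsWeakGrad O u)

/-- Membership in the Sobolev space `W^{k,q}(O)`. -/
def MemSobolev {d : ℕ} (O : Set (Space d)) :
    (k : ℕ) → {ι : Type} → [Fintype ι] → (q : ℝ≥0∞) → (u : Space d → EuclideanSpace ℝ ι) → Prop
  | 0, _, _, q, u => MemLp u q (volume.restrict O)
  | k + 1, _, _, q, u =>
      MemLp u q (volume.restrict O) ∧ ∃ G, IsWeakGrad O u G ∧ MemSobolev O k q G

/-- The Sobolev norm `‖u‖_{W^{k,q}(O)}`: the sum of the `L^q` norms of the weak derivatives of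
order at most `k`. The infimum runs over the a.e. unique weak gradient and gives `∞` if there is
none. -/
def sobolevNorm {d : ℕ} (O : Set (Space d)) :
    (k : ℕ) → {ι : Type} → [Fintype ι] → (q : ℝ≥0∞) → (u : Space d → EuclideanSpace ℝ ι) → ℝ≥0∞
  | 0, _, _, q, u => eLpNorm u q (volume.restrict O)
  | k + 1, _, _, q, u =>
      eLpNorm u q (volume.restrict O) + ⨅ G, ⨅ (_ : IsWeakGrad O u G), sobolevNorm O k q G

/-- The (classical) divergence of a vector field. -/
def divergence {d : ℕ} (h : Space d → Space d) (x : Space d) : ℝ :=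
  ∑ i, fderiv ℝ h x (EuclideanSpace.single i 1) i

/-- Membership in `W^{k,q}_div(O)`, the closure in `W^{k,q}(O)` of the vector fields that are smooth
and divergence-free in `O`. -/
def MemSobolevDiv {d : ℕ} (O : Set (Space d)) (k : ℕ) (q : ℝ≥0∞) (u : Space d → Space d) : Prop :=
  MemSobolev O k q u ∧ ∀ ε : ℝ≥0∞, 0 < ε → ∃ h : Space d → Space d,
    ContDiffOn ℝ ((⊤ : ℕ∞) : WithTop ℕ∞) h O ∧ (∀ x ∈ O, divergence h x = 0) ∧
      sobolevNorm O k q (u - h) < ε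

/-- The symmetric part of a matrix. -/
def symPart {d : ℕ} (A : Mat d) : Mat d :=
  WithLp.toLp 2 fun ji => (A ji + A (ji.2, ji.1)) / 2

/-- `sᵀ A`. For `A = ∇u`, `A (j, i) = ∂_j u_i`, this is `(s · ∇) u`. -/
def transposeMul {d : ℕ} (s : Space d) (A : Mat d) : Space d :=
  WithLp.toLp 2 fun i => ∑ j, s j * A (j, i)

/-- The viscous stress tensor `S(A) = (κ + |A|²)^{(p-2)/2} A`. -/
def stress {d : ℕ} (p κ : ℝ) (A : Mat d) : Mat d :=
  (κ + ‖A‖ ^ 2) ^ ((p - 2) / 2) • A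

/-- The space `𝕃²(O)` of square integrable vector fields. -/
abbrev VelocityL2 {d : ℕ} (O : Set (Space d)) : Type := Lp (Space d) 2 (volume.restrict O)

/-- `𝕃²(O)` carries its Borel `σ`-algebra. -/
instance instMeasurableSpaceVelocityL2 {d : ℕ} (O : Set (Space d)) :
    MeasurableSpace (VelocityL2 O) := borel _

instance instBorelSpaceVelocityL2 {d : ℕ} (O : Set (Space d)) : BorelSpace (VelocityL2 O) := ⟨rfl⟩

/-! ### Gradient discretisations -/

/-- A gradient discretisation, with finite dimensional real vector spaces `X` of discrete
velocities and `Y` of discrete pressures, reconstructions of the gradient, the symmetric gradient,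
the pressure, the divergence and the velocity. Since the reconstructions are linear, the `L^p` norm
of the reconstruction is a norm as soon as it is definite. -/
structure GradientDiscretisation {d : ℕ} (O : Set (Space d)) (p : ℝ) (X Y : Type*)
    [AddCommGroup X] [Module ℝ X] [FiniteDimensional ℝ X]
    [AddCommGroup Y] [Module ℝ Y] [FiniteDimensional ℝ Y] where
  grad : X →ₗ[ℝ] Lp (Mat d) (ENNReal.ofReal p) (volume.restrict O)
  symGrad : X →ₗ[ℝ] Lp (Mat d) (ENNReal.ofReal p) (volume.restrict O)
  symGrad_definite : ∀ v, ‖symGrad v‖ = 0 → v = 0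
  pressure : Y →ₗ[ℝ] Lp ℝ (ENNReal.ofReal (min p p.conjExponent)) (volume.restrict O)
  pressure_definite : ∀ q, ∫ x in O, pressure q x = 0 → ‖pressure q‖ = 0 → q = 0
  div : X →ₗ[ℝ] Lp ℝ (ENNReal.ofReal p) (volume.restrict O)
  velocity : X →ₗ[ℝ] VelocityL2 O
  velocity_injOn : Set.InjOn velocity
    {v | ∀ q, ∫ x in O, pressure q x = 0 → ∫ x in O, pressure q x * div v x = 0}

namespace GradientDiscretisation

variable {d : ℕ} {O : Set (Space d)} {p : ℝ} {X Y : Type*}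
  [AddCommGroup X] [Module ℝ X] [FiniteDimensional ℝ X]
  [AddCommGroup Y] [Module ℝ Y] [FiniteDimensional ℝ Y]

/-- `q` belongs to the space `Y_{D,0}` of mean-value free discrete pressures. -/
def MeanFree (D : GradientDiscretisation O p X Y) (q : Y) : Prop :=
  ∫ x in O, D.pressure q x = 0

/-- The set `E_{D,0}` of discretely divergence-free velocities. -/
def divFree (D : GradientDiscretisation O p X Y) : Set X :=
  {v | ∀ q, D.MeanFree q → ∫ x in O, D.pressure q x * D.div v x = 0}

/-- The coercivity constant `C_D(r)`. -/
def coercivityConst (D : GradientDiscretisation O p X Y) (r : ℝ≥0∞) : ℝ≥0∞ :=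
  ⨆ v : X, (eLpNorm (D.velocity v) r (volume.restrict O) + eLpNorm (D.div v) r (volume.restrict O)
      + eLpNorm (D.grad v) r (volume.restrict O)) / eLpNorm (D.symGrad v) r (volume.restrict O)

/-- The inf-sup constant `β_D(p)`; the infimum runs over the non-zero mean-value free pressures. -/
def infSupConst (D : GradientDiscretisation O p X Y) : ℝ≥0∞ :=
  ⨅ q : Y, ⨅ (_ : D.MeanFree q), ⨅ (_ : q ≠ 0), ⨆ v : X,
    ENNReal.ofReal (∫ x in O, D.pressure q x * D.div v x) /
      (eLpNorm (D.pressure q) (ENNReal.ofReal (min p p.conjExponent)) (volume.restrict O) *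
        (eLpNorm (D.symGrad v) (ENNReal.ofReal p) (volume.restrict O) +
          eLpNorm (D.symGrad v) (ENNReal.ofReal p.conjExponent) (volume.restrict O)))

/-- The `L²`-projection `K_D u` of `u ∈ 𝕃²(O)`: the element of `E_{D,0}` with
`(u - Π_D K_D u, Π_D ξ) = 0` for all `ξ ∈ E_{D,0}`. -/
def l2Proj (D : GradientDiscretisation O p X Y) (u : VelocityL2 O) : X :=
  Classical.epsilon fun v =>
    v ∈ D.divFree ∧ ∀ ξ ∈ D.divFree, inner ℝ (u - D.velocity v) (D.velocity ξ) = 0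

/-- The Sobolev-stability constant of the `L²`-projection at exponent `r`: the supremum over the
fields of `𝕃²(O)` (the domain of the projection) that belong to `W^{1,r}(O)`. -/
def sobolevConst (D : GradientDiscretisation O p X Y) (r : ℝ≥0∞) : ℝ≥0∞ :=
  ⨆ z : VelocityL2 O, ⨆ (_ : MemSobolev O 1 r z),
    eLpNorm (D.symGrad (D.l2Proj z)) r (volume.restrict O) / sobolevNorm O 1 r z

/-- `Γ`-stability of a gradient discretisation. The reconstructed symmetric gradients are in
`L^{p'}`, so that the constants at the exponent `p'` are formed with finite norms. -/
structure IsStable (D : GradientDiscretisation O p X Y) (Γ : ℝ≥0) : Prop where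
  symGrad_memLp : ∀ v, MemLp (D.symGrad v) (ENNReal.ofReal p.conjExponent) (volume.restrict O)
  coercivity : D.coercivityConst (ENNReal.ofReal p)
    + D.coercivityConst (ENNReal.ofReal p.conjExponent) ≤ Γ
  infSup : (Γ : ℝ≥0∞)⁻¹ ≤ D.infSupConst
  sobolev : D.sobolevConst (ENNReal.ofReal p)
    + D.sobolevConst (ENNReal.ofReal p.conjExponent) ≤ Γ

/-- The discrete noise coefficient `B_D^σ(v, ξ)`. -/
def noiseForm (D : GradientDiscretisation O p X Y) (σ : Space d → Space d) (v ξ : X) : ℝ :=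
  (1 / 2) * (∫ x in O, inner ℝ (transposeMul (σ x) (D.grad v x)) (D.velocity ξ x))
    - (1 / 2) * (∫ x in O, inner ℝ (D.velocity v x) (transposeMul (σ x) (D.grad ξ x)))

/-! ### The algorithm -/

/-- The discrete Helmholtz decomposition of `vin`, with velocity `s.1` and pressure `s.2`. -/
structure IsHelmholtz (D : GradientDiscretisation O p X Y) (vin : VelocityL2 O) (s : X × Y) :
    Prop where
  meanFree : D.MeanFree s.2
  momentum : ∀ ξ : X, inner ℝ (D.velocity s.1) (D.velocity ξ)
    + ∫ x in O, D.pressure s.2 x * D.div ξ x = inner ℝ vin (D.velocity ξ)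
  incompressible : ∀ q : Y, D.MeanFree q → ∫ x in O, D.div s.1 x * D.pressure q x = 0

/-- The average of two discrete velocities. -/
def midpoint (v w : X) : X := (1 / 2 : ℝ) • (w + v)

/-- `s'` is the (velocity, pressure) pair after one Crank--Nicolson step of size `τ` from the pair
`s`, with the increment `dW` of the noise. -/
structure IsStep (D : GradientDiscretisation O p X Y) (κ : ℝ) (g σ : Space d → Space d) (τ : ℝ)
    (dW : ℝ) (s s' : X × Y) : Prop where
  meanFree : D.MeanFree s'.2
  momentum : ∀ ξ : X,
    inner ℝ (D.velocity s'.1 - D.velocity s.1) (D.velocity ξ)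
      + τ * (∫ x in O, inner ℝ
          (stress p κ (D.symGrad (midpoint s.1 s'.1) x + symPart (weakGrad O g x)))
          (D.symGrad ξ x))
      - (∫ x in O, (D.pressure s'.2 x - D.pressure s.2 x) * D.div ξ x)
    = (D.noiseForm σ (midpoint s.1 s'.1) ξ
        + ∫ x in O, inner ℝ (transposeMul (σ x) (weakGrad O g x)) (D.velocity ξ x)) * dW
  incompressible : ∀ q : Y, D.MeanFree q →
    ∫ x in O, D.div (midpoint s.1 s'.1) x * D.pressure q x = 0

/-- The discrete (velocity, pressure) pairs generated by the algorithm from `vin`, pathwise for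
given noise increments `dW 0, dW 1, …`. Each step selects the solution of the nonlinear system
solved by the algorithm. -/
def trajectory (D : GradientDiscretisation O p X Y) (κ : ℝ) (g σ : Space d → Space d) (τ : ℝ)
    (vin : VelocityL2 O) (dW : ℕ → ℝ) : ℕ → X × Y
  | 0 => Classical.epsilon (D.IsHelmholtz vin)
  | n + 1 => Classical.epsilon (D.IsStep κ g σ τ (dW n) (trajectory D κ g σ τ vin dW n))

variable {Ω : Type*}

/-- The solution operator at integer times: the discrete velocity `v_D^n` started in `vin`, as a
function of the elementary event. -/
def solution (D : GradientDiscretisation O p X Y) (κ : ℝ) (g σ : Space d → Space d) (τ : ℝ≥0)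
    (W : ℝ≥0 → Ω → ℝ) (n : ℕ) (vin : VelocityL2 O) (ω : Ω) : X :=
  (D.trajectory κ g σ τ vin (fun m => W ((m + 1 : ℕ) * τ) ω - W (m * τ) ω) n).1

/-- The solution operator at shifted integer times: `(v_D^{n+1} + v_D^n) / 2`. -/
def solutionHalf (D : GradientDiscretisation O p X Y) (κ : ℝ) (g σ : Space d → Space d) (τ : ℝ≥0)
    (W : ℝ≥0 → Ω → ℝ) (n : ℕ) (vin : VelocityL2 O) (ω : Ω) : X :=
  midpoint (D.solution κ g σ τ W n vin ω) (D.solution κ g σ τ W (n + 1) vin ω)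

/-- The time-averaged law `μ^{1/2,N}_{τ,D}(vin; ·)` of the reconstructed velocity at shifted integer
times. -/
def averagedLawHalf [MeasurableSpace Ω] (D : GradientDiscretisation O p X Y) (κ : ℝ)
    (g σ : Space d → Space d) (τ : ℝ≥0) (W : ℝ≥0 → Ω → ℝ) (P : Measure Ω) (N : ℕ)
    (vin : VelocityL2 O) : Measure (VelocityL2 O) :=
  (N : ℝ≥0∞)⁻¹ •
    ∑ n ∈ Finset.range N, P.map (fun ω => D.velocity (D.solutionHalf κ g σ τ W n vin ω))

end GradientDiscretisation

/-- `W` is a real Wiener process with respect to the filtration `ℱ`. -/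
structure IsWienerProcess {Ω : Type*} {mΩ : MeasurableSpace Ω} (ℱ : Filtration ℝ≥0 mΩ)
    (W : ℝ≥0 → Ω → ℝ) (P : Measure Ω) : Prop where
  adapted : Adapted ℱ W
  brownian : IsBrownianReal W P
  indep : ∀ s t : ℝ≥0, s ≤ t →
    Indep (MeasurableSpace.comap (fun ω => W t ω - W s ω) inferInstance) (ℱ s) P

end GenStokes

end

/-! Everything takes place in the finite dimensional space `V = Π_D E_{D,0}` with the `L²` inner
product. Incompressibility puts the midpoint `w` of a step in `E_{D,0}`, and testing with discretely
divergence-free fields removes the pressure. Since the new velocity is `2w - v`, one step reads `2(w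
- v) + τ F(w) = s (B w + b)` in `V`, where `s` is the noise increment, `F` represents the stress and
is continuous, monotone and coercive of order `p`, and `B` represents the noise form and satisfies
`(B w, w) = 0`. Hence `w ↦ 2w + τ F(w) - s (B w + b)` is strongly monotone with constant 2 for every
`τ > 0` and every `s`, and Browder--Minty gives a unique solution that is continuous in `(v, s)`
(`exists_resolvent`). The pressure is recovered by duality (`exists_meanFree_pressureForm_eq`). The
velocities of the algorithm are therefore uniquely determined and measurable
(`exists_reduced_dynamics`).

Testing the step with `w` gives `(‖2w - v‖² - ‖v‖²)/2 + c ‖w‖^p ≤ C (1 + |s|^{p'})`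
(`exists_energy_const`): the `B` term vanishes and Young's inequality absorbs the `b` term. The sum
over `n < N` telescopes, and the Gaussian increments have a `p'`-th moment independent of `n`, so
the time average of `E ‖w‖^p` is bounded uniformly in `N`. By Markov's inequality and compactness of
closed balls in `V` the averaged laws are tight. Prokhorov's theorem in `V` yields a convergent
subsequence, and the isometric embedding of `V` into `𝕃²(O)` transports tightness and weak
convergence. -/

noncomputable section

namespace GenStokes

/-! ### Strongly monotone operators on finite dimensional spaces -/

section Monotone

variable {V : Type*} [NormedAddCommGroup V] [InnerProductSpace ℝ V]

/-- `A` is strongly monotone with constant `c`. -/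
def StronglyMonotone (c : ℝ) (A : V → V) : Prop :=
  ∀ x y, c * ‖x - y‖ ^ 2 ≤ inner ℝ (A x - A y) (x - y)

theorem StronglyMonotone.mul_norm_sub_le {c : ℝ} {A : V → V} (hA : StronglyMonotone c A)
    (x y : V) : c * ‖x - y‖ ≤ ‖A x - A y‖ := by
  rcases (norm_nonneg (x - y)).eq_or_lt with h | h
  · rw [← h, mul_zero]; positivity
  · have h1 := (hA x y).trans (real_inner_le_norm _ _)
    refine le_of_mul_le_mul_right ?_ h
    linarith [h1, sq ‖x - y‖]

/-- Strong monotonicity makes `A` antilipschitz, so in a proper space `A` is a proper map, and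
proper maps are closed. -/
theorem StronglyMonotone.isClosed_range {c : ℝ} (hc : 0 < c) {A : V → V}
    (hA : StronglyMonotone c A) (hcont : Continuous A) [FiniteDimensional ℝ V] :
    IsClosed (Set.range A) := by
  have h : AntilipschitzWith (Real.toNNReal c⁻¹) A := by
    refine AntilipschitzWith.of_le_mul_dist fun x y => ?_
    rw [Real.coe_toNNReal _ (inv_nonneg.2 hc.le), dist_eq_norm, dist_eq_norm,
      inv_mul_eq_div, le_div_iff₀ hc, mul_comm]
    exact hA.mul_norm_sub_le x y
  have : ProperSpace V := FiniteDimensional.proper ℝ V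
  have hproper : IsProperMap A := by
    rw [isProperMap_iff_tendsto_cocompact, ← Metric.cobounded_eq_cocompact]
    exact ⟨hcont, h.tendsto_cobounded⟩
  exact hproper.isClosedMap.isClosed_range

theorem StronglyMonotone.inner_fderiv {c : ℝ} {A : V → V} (hA : StronglyMonotone c A)
    {x : V} {A' : V →L[ℝ] V} (hd : HasFDerivAt A A' x) (h : V) :
    c * ‖h‖ ^ 2 ≤ inner ℝ (A' h) h := by
  have hline : HasDerivAt (fun t : ℝ => inner ℝ (A (x + t • h) - A x) h) (inner ℝ (A' h) h) 0 := by
    have h0 : HasDerivAt (fun t : ℝ => x + t • h) h 0 := by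
      simpa using ((hasDerivAt_id (0 : ℝ)).smul_const h).const_add x
    have h1 : HasFDerivAt A A' (x + (0 : ℝ) • h) := by simpa using hd
    have h2 := (h1.comp_hasDerivAt (0 : ℝ) h0).sub_const (A x)
    simpa using h2.inner ℝ (hasDerivAt_const (0 : ℝ) h)
  have hslope := hline.tendsto_slope_zero_right
  refine ge_of_tendsto hslope ?_
  filter_upwards [self_mem_nhdsWithin] with t ht
  have ht : 0 < t := ht
  have := hA (x + t • h) x
  simp only [add_sub_cancel_left, norm_smul, inner_smul_right, Real.norm_eq_abs,
    abs_of_pos ht] at this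
  simp only [zero_add, zero_smul, add_zero, sub_self, inner_zero_left, sub_zero, smul_eq_mul]
  rw [inv_mul_eq_div, le_div_iff₀ ht]
  refine le_of_mul_le_mul_left ?_ ht
  nlinarith

variable [FiniteDimensional ℝ V]

/-- The derivative is injective by `inner_fderiv`, hence bijective in finite dimension, so the range
is open. It is also closed, and `V` is connected. -/
theorem StronglyMonotone.surjective_of_contDiff {c : ℝ} (hc : 0 < c) {A : V → V}
    (hA : StronglyMonotone c A) (hd : ContDiff ℝ 1 A) : Function.Surjective A := by
  have : CompleteSpace V := FiniteDimensional.complete ℝ V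
  have hopen : IsOpen (Set.range A) := by
    rw [isOpen_iff_mem_nhds]
    rintro _ ⟨x, rfl⟩
    have hx : HasStrictFDerivAt A (fderiv ℝ A x) x := hd.contDiffAt.hasStrictFDerivAt (by simp)
    have hinj : Function.Injective (fderiv ℝ A x : V →ₗ[ℝ] V) := by
      rw [← LinearMap.ker_eq_bot, LinearMap.ker_eq_bot']
      intro h hh
      have := hA.inner_fderiv hx.hasFDerivAt h
      rw [show fderiv ℝ A x h = 0 from hh, inner_zero_left] at this
      have h2 : ‖h‖ ^ 2 ≤ 0 := by nlinarith
      simpa using le_antisymm h2 (sq_nonneg _)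
    have hsurj : Function.Surjective (fderiv ℝ A x : V →ₗ[ℝ] V) :=
      LinearMap.injective_iff_surjective.1 hinj
    rw [← hx.map_nhds_eq_of_surj (LinearMap.range_eq_top.2 hsurj)]
    exact range_mem_map
  have hclopen : IsClopen (Set.range A) := ⟨hA.isClosed_range hc hd.continuous, hopen⟩
  exact Set.range_eq_univ.1 (hclopen.eq_univ ⟨A 0, 0, rfl⟩)

open scoped Convolution in
/-- The Browder--Minty theorem for strongly monotone operators in finite dimension. -/
theorem StronglyMonotone.surjective {c : ℝ} (hc : 0 < c) {A : V → V}
    (hA : StronglyMonotone c A) (hcont : Continuous A) : Function.Surjective A := by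
  borelize V
  have : ProperSpace V := FiniteDimensional.proper ℝ V
  let μ : Measure V := Measure.addHaar
  let φ : ℕ → ContDiffBump (0 : V) := fun n =>
    ⟨1 / ((n : ℝ) + 1) / 2, 1 / ((n : ℝ) + 1), by positivity, half_lt_self (by positivity)⟩
  have hφ : Tendsto (fun n => (φ n).rOut) atTop (𝓝 0) := tendsto_one_div_add_atTop_nhds_zero_nat
  -- Mollification: averaging against a nonnegative bump of integral one yields smooth operators
  -- with the same monotonicity constant `c`.
  let B : ℕ → V → V := fun n => (φ n).normed μ ⋆[ContinuousLinearMap.lsmul ℝ ℝ, μ] A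
  have hint : ∀ n x, Integrable (fun t => (φ n).normed μ t • A (x - t)) μ := fun n x =>
    (((φ n).continuous_normed (μ := μ)).smul (hcont.comp (continuous_const.sub continuous_id)))
      |>.integrable_of_hasCompactSupport (φ n).hasCompactSupport_normed.smul_right
  have hBmono : ∀ n, StronglyMonotone c (B n) := by
    intro n x y
    have hsub : B n x - B n y = ∫ t, (φ n).normed μ t • (A (x - t) - A (y - t)) ∂μ := by
      simp only [smul_sub]
      rw [integral_sub (hint n x) (hint n y)]
      rfl
    have hsint : Integrable (fun t => (φ n).normed μ t • (A (x - t) - A (y - t))) μ := by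
      simpa only [smul_sub] using! (hint n x).sub (hint n y)
    rw [hsub, real_inner_comm, ← integral_inner hsint, ← one_mul (c * ‖x - y‖ ^ 2),
      ← (φ n).integral_normed (μ := μ), ← integral_mul_const]
    refine integral_mono ((φ n).integrable_normed.mul_const _) (hsint.const_inner _) fun t => ?_
    simp only [inner_smul_right]
    refine mul_le_mul_of_nonneg_left ?_ ((φ n).nonneg_normed t)
    have := hA (x - t) (y - t)
    rw [sub_sub_sub_cancel_right] at this
    rwa [real_inner_comm]
  have hBsmooth : ∀ n, ContDiff ℝ 1 (B n) := fun n =>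
    (φ n).hasCompactSupport_normed.contDiff_convolution_left (n := 1) _
      (φ n).contDiff_normed hcont.locallyIntegrable
  intro f
  choose w hw using fun n => (hBmono n).surjective_of_contDiff hc (hBsmooth n) f
  have hB0 : Tendsto (fun n => B n 0) atTop (𝓝 (A 0)) :=
    ContDiffBump.convolution_tendsto_right_of_continuous hφ hcont 0
  obtain ⟨R, hR⟩ := (hB0.const_sub f).norm.bddAbove_range
  -- The approximate solutions stay bounded because `c ‖w n‖ ≤ ‖f - B n 0‖` and `B n 0` converges.
  have hbdd : ∀ n, w n ∈ Metric.closedBall (0 : V) (R / c) := by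
    intro n
    have h1 := (hBmono n).mul_norm_sub_le (w n) 0
    rw [hw n, sub_zero] at h1
    rw [mem_closedBall_zero_iff, le_div_iff₀ hc, mul_comm]
    exact h1.trans (hR ⟨n, rfl⟩)
  obtain ⟨w₀, -, k, hk, hlim⟩ := (isCompact_closedBall (0 : V) (R / c)).tendsto_subseq hbdd
  refine ⟨w₀, ?_⟩
  have h1 : Tendsto (fun n => B (k n) (w (k n))) atTop (𝓝 (A w₀)) :=
    ContDiffBump.convolution_tendsto_right (φ := fun n => φ (k n)) (g := fun _ => A)
      (hφ.comp hk.tendsto_atTop) (Eventually.of_forall fun _ => hcont.aestronglyMeasurable)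
      ((hcont.tendsto w₀).comp tendsto_snd) hlim
  simp only [hw] at h1
  exact tendsto_nhds_unique h1 tendsto_const_nhds

end Monotone

/-! ### The stress tensor -/

section Stress

variable {d : ℕ} {p κ : ℝ}

/-- Bounding `r` by `(κ + r²)^{1/2}` turns the exponent into `(p - 1)/2 ≥ 0`, which treats `p < 2`
and `p ≥ 2` alike. -/
theorem rpow_mul_self_le (hp : 1 < p) (hκ : 0 ≤ κ) {r : ℝ} (hr : 0 ≤ r) :
    (κ + r ^ 2) ^ ((p - 2) / 2) * r ≤ (√κ + r) ^ (p - 1) := by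
  rcases hr.eq_or_lt with rfl | hr'
  · rw [mul_zero]; positivity
  have hpos : 0 < κ + r ^ 2 := by positivity
  have hs : √κ ^ 2 = κ := Real.sq_sqrt hκ
  have h1 : r ≤ (κ + r ^ 2) ^ ((1 : ℝ) / 2) := by
    rw [← Real.sqrt_eq_rpow]
    exact Real.le_sqrt_of_sq_le (by linarith)
  have h2 : κ + r ^ 2 ≤ (√κ + r) ^ 2 := by
    nlinarith [mul_nonneg (Real.sqrt_nonneg κ) hr]
  calc (κ + r ^ 2) ^ ((p - 2) / 2) * r
      ≤ (κ + r ^ 2) ^ ((p - 2) / 2) * (κ + r ^ 2) ^ ((1 : ℝ) / 2) := by gcongr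
    _ = (κ + r ^ 2) ^ ((p - 1) / 2) := by
        rw [← Real.rpow_add hpos]; congr 1; ring
    _ ≤ ((√κ + r) ^ 2) ^ ((p - 1) / 2) :=
        Real.rpow_le_rpow hpos.le h2 (by linarith)
    _ = (√κ + r) ^ (p - 1) := by
        rw [← Real.rpow_natCast, ← Real.rpow_mul (by positivity)]
        congr 1; push_cast; ring

theorem rpow_mul_self_mono (hp : 1 < p) (hκ : 0 ≤ κ) {r s : ℝ} (hr : 0 ≤ r) (hrs : r ≤ s) :
    (κ + r ^ 2) ^ ((p - 2) / 2) * r ≤ (κ + s ^ 2) ^ ((p - 2) / 2) * s := by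
  rcases hr.eq_or_lt with rfl | hr'
  · rw [mul_zero]; positivity
  -- Both factors on the right are nondecreasing in `t` for every `p > 1`, although the weight
  -- itself decreases when `p < 2`.
  have key : ∀ t : ℝ, 0 < t → (κ + t ^ 2) ^ ((p - 2) / 2) * t
      = (κ + t ^ 2) ^ ((p - 1) / 2) * √(t ^ 2 / (κ + t ^ 2)) := by
    intro t ht
    have hpos : 0 < κ + t ^ 2 := by positivity
    rw [Real.sqrt_div (sq_nonneg t), Real.sqrt_sq ht.le, Real.sqrt_eq_rpow, mul_div_assoc',
      mul_div_right_comm, ← Real.rpow_sub hpos]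
    congr 2; ring
  rw [key r hr', key s (hr'.trans_le hrs)]
  have hs : 0 < s := hr'.trans_le hrs
  have hsq : r ^ 2 ≤ s ^ 2 := by gcongr
  refine mul_le_mul (Real.rpow_le_rpow (by positivity) (by linarith) (by linarith))
    (Real.sqrt_le_sqrt ?_) (Real.sqrt_nonneg _) (by positivity)
  rw [div_le_div_iff₀ (by positivity) (by positivity)]
  nlinarith [mul_le_mul_of_nonneg_right hsq hκ]

theorem rpow_sub_le_rpow_mul_sq (hp : 1 < p) (hκ : 0 ≤ κ) {r : ℝ} (hr : 0 ≤ r) :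
    r ^ p - κ ^ (p / 2) ≤ (κ + r ^ 2) ^ ((p - 2) / 2) * r ^ 2 := by
  rcases hr.eq_or_lt with rfl | hr'
  · rw [Real.zero_rpow (by linarith)]
    have : 0 ≤ κ ^ (p / 2) := by positivity
    simpa using this
  have hpos : 0 < κ + r ^ 2 := by positivity
  have hrp : r ^ p = (r ^ 2) ^ ((p - 2) / 2) * r ^ 2 := by
    rw [← Real.rpow_natCast, ← Real.rpow_mul hr, ← Real.rpow_add hr']
    congr 1; push_cast; ring
  rcases le_or_gt 2 p with h2 | h2
  · have : (r ^ 2) ^ ((p - 2) / 2) ≤ (κ + r ^ 2) ^ ((p - 2) / 2) :=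
      Real.rpow_le_rpow (by positivity) (by linarith) (by linarith)
    have h3 : 0 ≤ κ ^ (p / 2) := by positivity
    rw [hrp]
    nlinarith [mul_le_mul_of_nonneg_right this (sq_nonneg r)]
  · have h1 : r ^ p ≤ (κ + r ^ 2) ^ (p / 2) := by
      rw [show r ^ p = (r ^ 2) ^ (p / 2) by
        rw [← Real.rpow_natCast, ← Real.rpow_mul hr]; congr 1; push_cast; ring]
      exact Real.rpow_le_rpow (by positivity) (by linarith) (by linarith)
    have h3 : (κ + r ^ 2) ^ (p / 2) = (κ + r ^ 2) ^ ((p - 2) / 2) * (κ + r ^ 2) := by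
      rw [← Real.rpow_add_one hpos.ne']; congr 1; ring
    have h4 : (κ + r ^ 2) ^ ((p - 2) / 2) * κ ≤ κ ^ (p / 2) := by
      rcases hκ.eq_or_lt with rfl | hκ'
      · rw [mul_zero]; positivity
      · have : κ ^ (p / 2) = κ ^ ((p - 2) / 2) * κ := by
          rw [← Real.rpow_add_one hκ'.ne']; congr 1; ring
        rw [this]
        exact mul_le_mul_of_nonneg_right
          (Real.rpow_le_rpow_of_nonpos hκ' (by nlinarith) (by linarith)) hκ
    nlinarith

theorem norm_stress (hκ : 0 ≤ κ) (A : Mat d) :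
    ‖stress p κ A‖ = (κ + ‖A‖ ^ 2) ^ ((p - 2) / 2) * ‖A‖ := by
  rw [stress, norm_smul, Real.norm_of_nonneg (by positivity)]

theorem norm_stress_le (hp : 1 < p) (hκ : 0 ≤ κ) (A : Mat d) :
    ‖stress p κ A‖ ≤ (√κ + ‖A‖) ^ (p - 1) := by
  rw [norm_stress hκ]
  exact rpow_mul_self_le hp hκ (norm_nonneg _)

/-- By Cauchy--Schwarz the pairing is at least `(a‖A‖ - b‖B‖)(‖A‖ - ‖B‖)` with the weights `a`, `b`
of `A`, `B`. This is nonnegative by radial monotonicity. -/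
theorem stress_monotone (hp : 1 < p) (hκ : 0 ≤ κ) (A B : Mat d) :
    0 ≤ inner ℝ (stress p κ A - stress p κ B) (A - B) := by
  simp only [stress, inner_sub_left, inner_sub_right, real_inner_smul_left,
    real_inner_self_eq_norm_sq, real_inner_comm A B]
  set a := (κ + ‖A‖ ^ 2) ^ ((p - 2) / 2) with ha
  set b := (κ + ‖B‖ ^ 2) ^ ((p - 2) / 2) with hb
  have ha0 : 0 ≤ a := by positivity
  have hb0 : 0 ≤ b := by positivity
  have hAB := real_inner_le_norm A B
  have h1 : 0 ≤ (a * ‖A‖ - b * ‖B‖) * (‖A‖ - ‖B‖) := by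
    rcases le_total ‖A‖ ‖B‖ with h | h
    · have := rpow_mul_self_mono hp hκ (norm_nonneg A) h
      exact mul_nonneg_of_nonpos_of_nonpos (by linarith) (by linarith)
    · have := rpow_mul_self_mono hp hκ (norm_nonneg B) h
      exact mul_nonneg (by linarith) (by linarith)
  nlinarith [mul_le_mul_of_nonneg_left hAB (add_nonneg ha0 hb0)]

theorem continuous_stress (hp : 1 < p) (hκ : 0 ≤ κ) : Continuous (stress p κ : Mat d → Mat d) := by
  rw [continuous_iff_continuousAt]
  intro A
  -- The weight can be singular only at `A = 0` with `κ = 0`; there the growth bound of order `p - 1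
  -- > 0` gives continuity.
  by_cases h : κ + ‖A‖ ^ 2 = 0
  · have hκ0 : κ = 0 := by nlinarith [sq_nonneg ‖A‖]
    have hA : A = 0 := by
      have : ‖A‖ ^ 2 = 0 := by linarith
      simpa using this
    subst hA hκ0
    have h0 : stress p 0 (0 : Mat d) = 0 := by simp [stress]
    rw [ContinuousAt, h0]
    refine squeeze_zero_norm (a := fun B : Mat d => (√0 + ‖B‖) ^ (p - 1))
      (norm_stress_le hp le_rfl) ?_
    have hc : Continuous fun B : Mat d => (√0 + ‖B‖) ^ (p - 1) :=
      (continuous_const.add continuous_norm).rpow_const fun _ => Or.inr (by linarith)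
    have := hc.tendsto 0
    simpa [Real.zero_rpow (by linarith : p - 1 ≠ 0)] using this
  · have h1 : ContinuousAt (fun B : Mat d => κ + ‖B‖ ^ 2) A := by fun_prop
    exact (h1.rpow_const (Or.inl h)).smul continuousAt_id

/-- Coercivity survives a bounded shift `G`. With `Z = A + G`, either `‖Z‖ ≥ 2M` and `Z : G` costs
at most half of `‖Z‖²`, or `‖Z‖ < 2M` and all terms are bounded. The factor `2^p` combines this half
with the `2^{p-1}` from convexity of the power. -/
theorem exists_norm_rpow_le_inner_stress (hp : 1 < p) (hκ : 0 ≤ κ) (M : ℝ) :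
    ∃ C : ℝ, ∀ A G : Mat d, ‖G‖ ≤ M →
      ‖A‖ ^ p ≤ 2 ^ p * inner ℝ (stress p κ (A + G)) A + C := by
  have hp0 : 0 < p := by linarith
  refine ⟨2 ^ (p - 1) * (2 * (κ ^ (p / 2) / 2 + (2 * M) ^ p / 2 + (√κ + 2 * M) ^ (p - 1) * M)
    + M ^ p), fun A G hG => ?_⟩
  have hM : 0 ≤ M := (norm_nonneg G).trans hG
  set Z := A + G with hZ
  have hA : A = Z - G := by simp [hZ]
  have hκp : 0 ≤ κ ^ (p / 2) := by positivity
  have hMp : 0 ≤ (2 * M) ^ p := by positivity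
  have hsM : 0 ≤ (√κ + 2 * M) ^ (p - 1) * M := by positivity
  have hin : ‖Z‖ ^ p / 2 - (κ ^ (p / 2) / 2 + (2 * M) ^ p / 2 + (√κ + 2 * M) ^ (p - 1) * M)
      ≤ inner ℝ (stress p κ Z) A := by
    have h1 : inner ℝ (stress p κ Z) A
        = (κ + ‖Z‖ ^ 2) ^ ((p - 2) / 2) * (‖Z‖ ^ 2 - inner ℝ Z G) := by
      rw [hA, stress, real_inner_smul_left, inner_sub_right, real_inner_self_eq_norm_sq]
    have h2 : inner ℝ Z G ≤ ‖Z‖ * M :=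
      (real_inner_le_norm _ _).trans (by gcongr)
    have hm : 0 ≤ (κ + ‖Z‖ ^ 2) ^ ((p - 2) / 2) := by positivity
    rw [h1]
    rcases le_or_gt (2 * M) ‖Z‖ with h3 | h3
    · have h4 := rpow_sub_le_rpow_mul_sq hp hκ (norm_nonneg Z)
      have h5 : ‖Z‖ ^ 2 / 2 ≤ ‖Z‖ ^ 2 - inner ℝ Z G := by nlinarith [norm_nonneg Z]
      nlinarith [mul_le_mul_of_nonneg_left h5 hm]
    · have h4 : ‖Z‖ ^ p ≤ (2 * M) ^ p := by gcongr
      have h5 : (κ + ‖Z‖ ^ 2) ^ ((p - 2) / 2) * ‖Z‖ ≤ (√κ + 2 * M) ^ (p - 1) :=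
        (rpow_mul_self_le hp hκ (norm_nonneg Z)).trans
          (Real.rpow_le_rpow (by positivity) (by linarith) (by linarith))
      have h6 : -(‖Z‖ * M) ≤ ‖Z‖ ^ 2 - inner ℝ Z G := by nlinarith [sq_nonneg ‖Z‖]
      nlinarith [mul_le_mul_of_nonneg_left h6 hm, mul_le_mul_of_nonneg_right h5 hM]
  have hAp : ‖A‖ ^ p ≤ 2 ^ (p - 1) * (‖Z‖ ^ p + M ^ p) := by
    have h1 : ‖A‖ ≤ ‖Z‖ + M := by
      rw [hA]; exact (norm_sub_le _ _).trans (by gcongr)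
    refine (Real.rpow_le_rpow (norm_nonneg _) h1 hp0.le).trans ?_
    lift M to ℝ≥0 using hM
    exact_mod_cast NNReal.rpow_add_le_mul_rpow_add_rpow ‖Z‖₊ M hp.le
  have h2p : (2 : ℝ) ^ p = 2 ^ (p - 1) * 2 := by
    rw [← Real.rpow_add_one two_ne_zero]; congr 1; ring
  have hpos : (0 : ℝ) < 2 ^ (p - 1) := by positivity
  rw [h2p]
  nlinarith [mul_le_mul_of_nonneg_left hin hpos.le]

end Stress

/-! ### Function spaces -/

section FunctionSpaces

variable {d : ℕ} {O : Set (Space d)}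

theorem IsPolygonalDomain.isOpen (hO : IsPolygonalDomain O) : IsOpen O := by
  obtain ⟨T, rfl⟩ := hO.polygonal
  exact isOpen_interior

theorem IsPolygonalDomain.isFiniteMeasure (hO : IsPolygonalDomain O) :
    IsFiniteMeasure (volume.restrict O) := by
  obtain ⟨T, hT⟩ := hO.polygonal
  have hK : IsCompact (⋃ t ∈ T, convexHull ℝ (t : Set (Space d))) :=
    T.isCompact_biUnion fun t _ => t.finite_toSet.isCompact_convexHull ℝ
  refine ⟨?_⟩
  rw [Measure.restrict_apply_univ, hT]
  exact (measure_mono interior_subset).trans_lt hK.measure_lt_top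

variable {ι : Type} [Fintype ι]

theorem LocallyIntegrableOn.apply {u : Space d → EuclideanSpace ℝ ι}
    (hu : LocallyIntegrableOn u O) (i : ι) : LocallyIntegrableOn (fun x => u x i) O := by
  intro x hx
  obtain ⟨s, hs, h⟩ := hu x hx
  exact ⟨s, hs, (EuclideanSpace.proj (𝕜 := ℝ) i).integrable_comp h⟩

theorem integrableOn_mul_of_tsupport_subset {f φ : Space d → ℝ} (hf : LocallyIntegrableOn f O)
    (hφ : Continuous φ) (hc : HasCompactSupport φ) (hs : tsupport φ ⊆ O) :
    IntegrableOn (fun x => φ x * f x) O := by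
  have h1 : IntegrableOn (fun x => φ x * f x) (tsupport φ) :=
    (hf.integrableOn_compact_subset hs hc).continuousOn_mul hφ.continuousOn hc
  exact (h1.integrable_of_forall_notMem_eq_zero fun x hx => by
    rw [image_eq_zero_of_notMem_tsupport hx, zero_mul]).integrableOn

/-- Fundamental lemma of the calculus of variations, applied entrywise. It makes the arbitrary
choice in `weakGrad` harmless and lets it inherit Sobolev regularity. -/
theorem IsWeakGrad.ae_eq (hO : IsOpen O) {u : Space d → EuclideanSpace ℝ ι}
    {G H : Space d → EuclideanSpace ℝ (Fin d × ι)} (hG : IsWeakGrad O u G)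
    (hH : IsWeakGrad O u H) : G =ᵐ[volume.restrict O] H := by
  have key : ∀ k : Fin d × ι, ∀ᵐ x, x ∈ O → G x k - H x k = 0 := by
    rintro ⟨j, i⟩
    have hGl := LocallyIntegrableOn.apply hG.locallyIntegrable_grad (j, i)
    have hHl := LocallyIntegrableOn.apply hH.locallyIntegrable_grad (j, i)
    refine hO.ae_eq_zero_of_integral_contDiff_smul_eq_zero (hGl.sub hHl) fun φ hφ hc hs => ?_
    have h1 := hG.integral_eq φ hφ hc hs j i
    rw [hH.integral_eq φ hφ hc hs j i, neg_inj] at h1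
    rw [← setIntegral_eq_integral_of_forall_compl_eq_zero (s := O)]
    · simp only [smul_eq_mul, mul_sub]
      rw [integral_sub (integrableOn_mul_of_tsupport_subset hGl hφ.continuous hc hs)
        (integrableOn_mul_of_tsupport_subset hHl hφ.continuous hc hs), h1, sub_self]
    · intro x hx
      rw [image_eq_zero_of_notMem_tsupport fun h => hx (hs h), zero_smul]
  rw [Filter.EventuallyEq, ae_restrict_iff' hO.measurableSet]
  filter_upwards [ae_all_iff.2 key] with x hx hxO
  ext k
  exact sub_eq_zero.1 (hx k hxO)

theorem MemSobolev.memLp {k : ℕ} {q : ℝ≥0∞} {u : Space d → EuclideanSpace ℝ ι}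
    (h : MemSobolev O k q u) : MemLp u q (volume.restrict O) := by
  cases k with
  | zero => exact h
  | succ k => exact h.1

theorem MemSobolev.memLp_weakGrad (hO : IsOpen O) {k : ℕ} {q : ℝ≥0∞}
    {u : Space d → EuclideanSpace ℝ ι} (h : MemSobolev O (k + 1) q u) :
    MemLp (weakGrad O u) q (volume.restrict O) := by
  obtain ⟨-, G, hG, hGs⟩ := h
  have h1 : IsWeakGrad O u (weakGrad O u) := Classical.epsilon_spec ⟨G, hG⟩
  exact hGs.memLp.ae_eq (hG.ae_eq hO h1)

theorem exists_ae_norm_le_of_memLp_top {α E : Type*} {mα : MeasurableSpace α} {μ : Measure α}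
    [NormedAddCommGroup E] {f : α → E} (hf : MemLp f ⊤ μ) :
    ∃ M : ℝ, 0 ≤ M ∧ ∀ᵐ x ∂μ, ‖f x‖ ≤ M := by
  refine ⟨(eLpNorm f ⊤ μ).toReal, ENNReal.toReal_nonneg, ?_⟩
  have h := hf.eLpNorm_lt_top.ne
  rw [eLpNorm_exponent_top] at h ⊢
  filter_upwards [ae_le_eLpNormEssSup (f := f) (μ := μ)] with x hx
  simpa using ENNReal.toReal_mono h hx

theorem memLp_symPart {q : ℝ≥0∞} {μ : Measure (Space d)} {f : Space d → Mat d}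
    (hf : MemLp f q μ) : MemLp (fun x => symPart (f x)) q μ := by
  let L : Mat d →ₗ[ℝ] Mat d :=
    { toFun := symPart
      map_add' := fun A B => by ext k; simp [symPart]; ring
      map_smul' := fun c A => by ext k; simp [symPart]; ring }
  exact L.toContinuousLinearMap.comp_memLp' hf

theorem transposeMul_add (s : Space d) (A B : Mat d) :
    transposeMul s (A + B) = transposeMul s A + transposeMul s B := by
  ext i; simp [transposeMul, mul_add, Finset.sum_add_distrib]

theorem transposeMul_smul (s : Space d) (c : ℝ) (A : Mat d) :
    transposeMul s (c • A) = c • transposeMul s A := by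
  ext i; simp [transposeMul, Finset.mul_sum, mul_left_comm]

theorem norm_transposeMul_le (s : Space d) (A : Mat d) : ‖transposeMul s A‖ ≤ ‖s‖ * ‖A‖ := by
  rw [EuclideanSpace.norm_eq, EuclideanSpace.norm_eq s, EuclideanSpace.norm_eq A,
    ← Real.sqrt_mul (by positivity)]
  refine Real.sqrt_le_sqrt ?_
  simp only [Real.norm_eq_abs, sq_abs, transposeMul]
  rw [Fintype.sum_prod_type_right, Finset.mul_sum]
  exact Finset.sum_le_sum fun i _ => Finset.sum_mul_sq_le_sq_mul_sq _ _ _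

theorem memLp_transposeMul {q : ℝ≥0∞} {μ : Measure (Space d)} {σ : Space d → Space d}
    {f : Space d → Mat d} (hσ : MemLp σ ⊤ μ) (hf : MemLp f q μ) :
    MemLp (fun x => transposeMul (σ x) (f x)) q μ := by
  obtain ⟨M, hM, hσM⟩ := exists_ae_norm_le_of_memLp_top hσ
  have hcont : Continuous fun y : Space d × Mat d => transposeMul y.1 y.2 := by
    unfold transposeMul; fun_prop
  refine hf.of_le_mul (c := M)
    (hcont.comp_aestronglyMeasurable (hσ.aestronglyMeasurable.prodMk hf.aestronglyMeasurable)) ?_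
  filter_upwards [hσM] with x hx
  exact (norm_transposeMul_le _ _).trans (by gcongr)

theorem integrable_inner_of_memLp {α E : Type*} {mα : MeasurableSpace α} {μ : Measure α}
    [NormedAddCommGroup E] [InnerProductSpace ℝ E] {f g : α → E} {p q : ℝ≥0∞}
    [ENNReal.HolderConjugate p q] (hf : MemLp f p μ) (hg : MemLp g q μ) :
    Integrable (fun x => inner ℝ (f x) (g x)) μ := by
  refine (hf.norm.integrable_mul hg.norm).mono
    (hf.aestronglyMeasurable.inner hg.aestronglyMeasurable) (Eventually.of_forall fun x => ?_)
  simpa using abs_real_inner_le_norm (f x) (g x)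

theorem ofReal_holderConjugate {p : ℝ} (hp : 1 < p) :
    ENNReal.HolderConjugate (ENNReal.ofReal p) (ENNReal.ofReal p.conjExponent) :=
  (Real.HolderConjugate.conjExponent hp).ennrealOfReal

end FunctionSpaces

/-! ### The stress functional on finite dimensional spaces -/

section StressPairing

variable {d : ℕ} {p κ : ℝ} {α : Type*} {mα : MeasurableSpace α} {μ : Measure α}

/-- A single `p`-th power majorises the pairing. It gives integrability, and with `a` a common bound
for varying `A` it is the dominating function for continuity. -/
theorem norm_inner_stress_le (hp : 1 < p) (hκ : 0 ≤ κ) (A B : Mat d) {a : ℝ} (ha : ‖A‖ ≤ a) :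
    ‖inner ℝ (stress p κ A) B‖ ≤ (√κ + a + ‖B‖) ^ p := by
  have h0 : 0 ≤ √κ + ‖A‖ := by positivity
  have ha0 : 0 ≤ a := (norm_nonneg _).trans ha
  have h2 : (√κ + ‖A‖) ^ (p - 1) ≤ (√κ + a + ‖B‖) ^ (p - 1) :=
    Real.rpow_le_rpow h0 (by linarith [norm_nonneg B]) (by linarith)
  calc ‖inner ℝ (stress p κ A) B‖ ≤ ‖stress p κ A‖ * ‖B‖ := norm_inner_le_norm _ _
    _ ≤ (√κ + a + ‖B‖) ^ (p - 1) * (√κ + a + ‖B‖) :=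
        mul_le_mul ((norm_stress_le hp hκ A).trans h2)
          (by linarith [Real.sqrt_nonneg κ]) (norm_nonneg _) (by positivity)
    _ = (√κ + a + ‖B‖) ^ p := by
        rw [← Real.rpow_add_one' (by positivity) (by linarith)]; congr 1; ring

theorem integrable_rpow_of_memLp (hp : 1 < p) {m : α → ℝ} (hm : MemLp m (ENNReal.ofReal p) μ)
    (hm0 : ∀ x, 0 ≤ m x) : Integrable (fun x => m x ^ p) μ := by
  have := hm.integrable_norm_rpow (by simp; linarith) ENNReal.ofReal_ne_top
  rw [ENNReal.toReal_ofReal (by linarith)] at this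
  simpa only [Real.norm_of_nonneg (hm0 _)] using this

variable [IsFiniteMeasure μ]

theorem integrable_inner_stress (hp : 1 < p) (hκ : 0 ≤ κ) {U H : α → Mat d}
    (hU : MemLp U (ENNReal.ofReal p) μ) (hH : MemLp H (ENNReal.ofReal p) μ) :
    Integrable (fun x => inner ℝ (stress p κ (U x)) (H x)) μ := by
  have hm : MemLp (fun x => √κ + ‖U x‖ + ‖H x‖) (ENNReal.ofReal p) μ :=
    ((memLp_const (√κ)).add hU.norm).add hH.norm
  have hmeas : AEStronglyMeasurable (fun x => inner ℝ (stress p κ (U x)) (H x)) μ :=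
    ((continuous_stress hp hκ).comp_aestronglyMeasurable hU.aestronglyMeasurable).inner
      hH.aestronglyMeasurable
  have hm0 : ∀ x, 0 ≤ √κ + ‖U x‖ + ‖H x‖ := fun x => by positivity
  refine (integrable_rpow_of_memLp hp hm hm0).mono' hmeas (Eventually.of_forall fun x => ?_)
  exact norm_inner_stress_le hp hκ (U x) (H x) le_rfl

theorem continuous_integral_inner_stress (hp : 1 < p) (hκ : 0 ≤ κ)
    {V : Type*} [NormedAddCommGroup V] [NormedSpace ℝ V] [FiniteDimensional ℝ V]
    (L : V →ₗ[ℝ] Lp (Mat d) (ENNReal.ofReal p) μ) {G H : α → Mat d}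
    (hG : MemLp G (ENNReal.ofReal p) μ) (hH : MemLp H (ENNReal.ofReal p) μ) :
    Continuous fun w => ∫ x, inner ℝ (stress p κ (L w x + G x)) (H x) ∂μ := by
  let b := Module.finBasis ℝ V
  -- The class `L w` determines its representative only almost everywhere. Expanding in a basis
  -- gives representatives that are linear in `w` at every point, as dominated convergence needs.
  let f : V → α → Mat d := fun w x => ∑ i, b.repr w i • L (b i) x
  have hf : ∀ w, L w =ᵐ[μ] f w := by
    intro w
    have h1 : L w = ∑ i, b.repr w i • L (b i) := by
      conv_lhs => rw [← b.sum_repr w, map_sum]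
      simp only [map_smul]
    have h2 : ∀ᵐ x ∂μ, ∀ i, (b.repr w i • L (b i) : Lp (Mat d) _ μ) x = b.repr w i • L (b i) x :=
      ae_all_iff.2 fun i => Lp.coeFn_smul _ _
    rw [h1]
    filter_upwards [h2, Lp.coeFn_finsetSum Finset.univ fun i => b.repr w i • L (b i)]
      with x hx hx'
    rw [hx', Finset.sum_apply]
    exact Finset.sum_congr rfl fun i _ => hx i
  have hcoord : ∀ i, Continuous fun w => b.repr w i := fun i =>
    (b.coord i).continuous_of_finiteDimensional
  have heq : (fun w => ∫ x, inner ℝ (stress p κ (L w x + G x)) (H x) ∂μ)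
      = fun w => ∫ x, inner ℝ (stress p κ (f w x + G x)) (H x) ∂μ := by
    funext w
    refine integral_congr_ae ?_
    filter_upwards [hf w] with x hx
    rw [hx]
  rw [heq, continuous_iff_continuousAt]
  intro w₀
  let K : Fin (Module.finrank ℝ V) → ℝ := fun i => ‖b.repr w₀ i‖ + 1
  have hK : ∀ᶠ w in 𝓝 w₀, ∀ i, ‖b.repr w i‖ ≤ K i := by
    rw [eventually_all]
    intro i
    exact ((hcoord i).norm.tendsto w₀).eventually_le_const (lt_add_one _)
  have hm : MemLp (fun x => √κ + (∑ i, K i * ‖L (b i) x‖ + ‖G x‖) + ‖H x‖)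
      (ENNReal.ofReal p) μ := by
    have h1 : MemLp (fun x => ∑ i, K i * ‖L (b i) x‖) (ENNReal.ofReal p) μ :=
      memLp_finsetSum _ fun i _ => (Lp.memLp (L (b i))).norm.const_mul (K i)
    exact ((memLp_const (√κ)).add (h1.add hG.norm)).add hH.norm
  have hK0 : ∀ i, 0 ≤ K i := fun i => by positivity
  have hm0 : ∀ x, 0 ≤ √κ + (∑ i, K i * ‖L (b i) x‖ + ‖G x‖) + ‖H x‖ := fun x => by
    have := Finset.sum_nonneg fun i (_ : i ∈ Finset.univ) =>
      mul_nonneg (hK0 i) (norm_nonneg (L (b i) x))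
    positivity
  refine continuousAt_of_dominated ?_ ?_ (integrable_rpow_of_memLp hp hm hm0) ?_
  · refine Eventually.of_forall fun w => ?_
    have hfm : AEStronglyMeasurable (f w) μ := (Lp.aestronglyMeasurable (L w)).congr (hf w)
    exact ((continuous_stress hp hκ).comp_aestronglyMeasurable
      (hfm.add hG.aestronglyMeasurable)).inner hH.aestronglyMeasurable
  · filter_upwards [hK] with w hw
    refine Eventually.of_forall fun x => norm_inner_stress_le hp hκ (f w x + G x) (H x) ?_
    refine (norm_add_le _ _).trans (add_le_add_left ((norm_sum_le _ _).trans ?_) _)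
    refine Finset.sum_le_sum fun i _ => ?_
    rw [norm_smul]
    exact mul_le_mul_of_nonneg_right (hw i) (norm_nonneg _)
  · refine Eventually.of_forall fun x => ?_
    have hfc : Continuous fun w => f w x :=
      continuous_finsetSum _ fun i _ => (hcoord i).smul continuous_const
    exact (((continuous_stress hp hκ).comp (hfc.add continuous_const)).inner
      continuous_const).continuousAt

end StressPairing

/-! ### Duality in finite dimension -/

section Duality

variable {V : Type*} [NormedAddCommGroup V] [InnerProductSpace ℝ V] [FiniteDimensional ℝ V]

theorem exists_inner_eq (l : V →ₗ[ℝ] ℝ) : ∃ z : V, ∀ v, inner ℝ z v = l v := by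
  have : CompleteSpace V := FiniteDimensional.complete ℝ V
  exact ⟨(InnerProductSpace.toDual ℝ V).symm l.toContinuousLinearMap, fun v => by simp⟩

theorem continuous_of_continuous_inner {T : Type*} [TopologicalSpace T] {F : T → V}
    (h : ∀ v, Continuous fun t => inner ℝ (F t) v) : Continuous F := by
  let b := stdOrthonormalBasis ℝ V
  have : F = fun t => ∑ i, inner ℝ (F t) (b i) • b i := by
    funext t
    conv_lhs => rw [← b.sum_repr' (F t)]
    simp only [real_inner_comm]
  rw [this]
  exact continuous_finsetSum _ fun i _ => (h (b i)).smul continuous_const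

/-- The range of `F` is a finite dimensional subspace of the dual, hence equals the annihilator of
its own coannihilator. -/
theorem exists_eq_of_forall_eq_zero {X Z : Type*} [AddCommGroup X] [Module ℝ X]
    [AddCommGroup Z] [Module ℝ Z] [FiniteDimensional ℝ Z]
    (F : Z →ₗ[ℝ] X →ₗ[ℝ] ℝ) (l : X →ₗ[ℝ] ℝ) (h : ∀ v, (∀ q, F q v = 0) → l v = 0) :
    ∃ q, F q = l := by
  have hl : l ∈ (LinearMap.range F).dualCoannihilator.dualAnnihilator := by
    rw [Submodule.mem_dualAnnihilator]
    intro v hv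
    rw [Submodule.mem_dualCoannihilator] at hv
    exact h v fun q => hv _ ⟨q, rfl⟩
  rw [Subspace.dualCoannihilator_dualAnnihilator_eq] at hl
  exact hl

end Duality

/-! ### The forms of a stable gradient discretisation -/

namespace GradientDiscretisation

variable {d : ℕ} {O : Set (Space d)} {p κ : ℝ} {X Y : Type*}
  [AddCommGroup X] [Module ℝ X] [FiniteDimensional ℝ X]
  [AddCommGroup Y] [Module ℝ Y] [FiniteDimensional ℝ Y]
  {D : GradientDiscretisation O p X Y} {Γ : ℝ≥0}

/-- A finite coercivity constant turns `L^r` integrability of the symmetric gradient into that of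
velocity, divergence and gradient. At `r = p'` this gives meaning to the pairings below. -/
theorem eLpNorm_add_lt_top {r : ℝ≥0∞} (hr : D.coercivityConst r ≤ Γ) {v : X}
    (hv : MemLp (D.symGrad v) r (volume.restrict O)) :
    eLpNorm (D.velocity v) r (volume.restrict O) + eLpNorm (D.div v) r (volume.restrict O)
      + eLpNorm (D.grad v) r (volume.restrict O) < ⊤ := by
  have h1 := (le_iSup_iff.2 fun b hb => hb v).trans hr
  have hfin := hv.eLpNorm_lt_top
  rw [ENNReal.div_le_iff_le_mul (Or.inr ENNReal.coe_ne_top) (Or.inl hfin.ne)] at h1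
  exact h1.trans_lt (ENNReal.mul_lt_top ENNReal.coe_lt_top hfin)

theorem IsStable.memLp_div (hD : D.IsStable Γ) (v : X) :
    MemLp (D.div v) (ENNReal.ofReal p.conjExponent) (volume.restrict O) := by
  have := eLpNorm_add_lt_top (le_add_self.trans hD.coercivity) (hD.symGrad_memLp v)
  exact ⟨Lp.aestronglyMeasurable _, (le_self_add.trans' le_add_self).trans_lt this⟩

theorem IsStable.memLp_velocity (hD : D.IsStable Γ) (v : X) :
    MemLp (D.velocity v) (ENNReal.ofReal p.conjExponent) (volume.restrict O) := by
  have := eLpNorm_add_lt_top (le_add_self.trans hD.coercivity) (hD.symGrad_memLp v)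
  exact ⟨Lp.aestronglyMeasurable _, (le_self_add.trans' le_self_add).trans_lt this⟩

/-- The pressure lies in `L^{min(p,p')}`, and the divergence lies in both `L^p` and `L^{p'}`, so
Hölder applies whichever exponent is smaller. -/
theorem IsStable.integrable_pressure_mul_div (hp : 1 < p) (hD : D.IsStable Γ) (q : Y) (v : X) :
    Integrable (fun x => D.pressure q x * D.div v x) (volume.restrict O) := by
  have hpq := ofReal_holderConjugate hp
  have hq : ∀ r, min p p.conjExponent = r →
      MemLp (D.pressure q) (ENNReal.ofReal r) (volume.restrict O) := by
    rintro r rfl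
    exact Lp.memLp _
  rcases le_total p p.conjExponent with h | h
  · exact (hq p (min_eq_left h)).integrable_mul (hD.memLp_div v)
  · have := hpq.symm
    exact (hq _ (min_eq_right h)).integrable_mul (Lp.memLp (D.div v))

/-- The bilinear form `(χ_D q, div_D v)`. -/
def pressureForm (hp : 1 < p) (hD : D.IsStable Γ) : Y →ₗ[ℝ] X →ₗ[ℝ] ℝ :=
  LinearMap.mk₂ ℝ (fun q v => ∫ x in O, D.pressure q x * D.div v x)
    (fun q r v => by
      rw [← integral_add (hD.integrable_pressure_mul_div hp q v)
        (hD.integrable_pressure_mul_div hp r v)]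
      refine integral_congr_ae ?_
      rw [map_add]
      filter_upwards [Lp.coeFn_add (D.pressure q) (D.pressure r)] with x hx
      rw [hx, Pi.add_apply, add_mul])
    (fun c q v => by
      rw [smul_eq_mul, ← integral_const_mul]
      refine integral_congr_ae ?_
      rw [map_smul]
      filter_upwards [Lp.coeFn_smul c (D.pressure q)] with x hx
      rw [hx, Pi.smul_apply, smul_eq_mul, mul_assoc])
    (fun q v w => by
      rw [← integral_add (hD.integrable_pressure_mul_div hp q v)
        (hD.integrable_pressure_mul_div hp q w)]
      refine integral_congr_ae ?_
      rw [map_add]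
      filter_upwards [Lp.coeFn_add (D.div v) (D.div w)] with x hx
      rw [hx, Pi.add_apply, mul_add])
    (fun c q v => by
      rw [smul_eq_mul, ← integral_const_mul]
      refine integral_congr_ae ?_
      rw [map_smul]
      filter_upwards [Lp.coeFn_smul c (D.div v)] with x hx
      rw [hx, Pi.smul_apply, smul_eq_mul, mul_left_comm])

theorem pressureForm_apply (hp : 1 < p) (hD : D.IsStable Γ) (q : Y) (v : X) :
    pressureForm hp hD q v = ∫ x in O, D.pressure q x * D.div v x := rfl

theorem integral_pressure_sub_mul_div (hp : 1 < p) (hD : D.IsStable Γ) (q r : Y) (v : X) :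
    ∫ x in O, (D.pressure q x - D.pressure r x) * D.div v x = pressureForm hp hD (q - r) v := by
  rw [map_sub, LinearMap.sub_apply, pressureForm_apply, pressureForm_apply,
    ← integral_sub (hD.integrable_pressure_mul_div hp q v)
      (hD.integrable_pressure_mul_div hp r v)]
  simp only [sub_mul]

theorem one_le_ofReal_min (hp : 1 < p) : 1 ≤ ENNReal.ofReal (min p p.conjExponent) := by
  rw [ENNReal.one_le_ofReal]
  exact le_min hp.le (Real.HolderConjugate.conjExponent hp).symm.lt.le

theorem mem_divFree_iff (hp : 1 < p) (hD : D.IsStable Γ) {v : X} :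
    v ∈ D.divFree ↔ ∀ q, D.MeanFree q → pressureForm hp hD q v = 0 := Iff.rfl

theorem mem_divFree_iff_integral_div_mul {v : X} :
    v ∈ D.divFree ↔ ∀ q, D.MeanFree q → ∫ x in O, D.div v x * D.pressure q x = 0 := by
  have h : ∀ q, ∫ x in O, D.div v x * D.pressure q x = ∫ x in O, D.pressure q x * D.div v x :=
    fun q => integral_congr_ae (Eventually.of_forall fun x => mul_comm (D.div v x) _)
  exact forall₂_congr fun q _ => by rw [h q]

/-- The subspace `E_{D,0}`. -/
def divFreeSubmodule (hp : 1 < p) (hD : D.IsStable Γ) : Submodule ℝ X where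
  carrier := D.divFree
  zero_mem' := (mem_divFree_iff hp hD).2 fun q _ => map_zero _
  add_mem' := fun {v w} hv hw => (mem_divFree_iff hp hD).2 fun q hq => by
    rw [map_add, (mem_divFree_iff hp hD).1 hv q hq, (mem_divFree_iff hp hD).1 hw q hq, add_zero]
  smul_mem' := fun c v hv => (mem_divFree_iff hp hD).2 fun q hq => by
    rw [map_smul, (mem_divFree_iff hp hD).1 hv q hq, smul_zero]

section MeanFree

variable [IsFiniteMeasure (volume.restrict O)]

theorem integrable_pressure (hp : 1 < p) (q : Y) :
    Integrable (D.pressure q) (volume.restrict O) :=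
  (Lp.memLp (D.pressure q)).integrable (one_le_ofReal_min hp)

/-- The subspace `Y_{D,0}`. -/
def meanFreeSubmodule (D : GradientDiscretisation O p X Y) (hp : 1 < p) : Submodule ℝ Y where
  carrier := {q | D.MeanFree q}
  zero_mem' := by
    change ∫ x in O, D.pressure 0 x = 0
    rw [map_zero, integral_congr_ae (Lp.coeFn_zero _ _ _)]
    simp
  add_mem' := fun {q r} hq hr => by
    change ∫ x in O, D.pressure (q + r) x = 0
    rw [map_add, integral_congr_ae (Lp.coeFn_add _ _)]
    simp only [Pi.add_apply]
    rw [integral_add (integrable_pressure hp q) (integrable_pressure hp r),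
      show ∫ x in O, D.pressure q x = 0 from hq, show ∫ x in O, D.pressure r x = 0 from hr,
      add_zero]
  smul_mem' := fun c q hq => by
    change ∫ x in O, D.pressure (c • q) x = 0
    rw [map_smul, integral_congr_ae (Lp.coeFn_smul _ _)]
    simp only [Pi.smul_apply]
    rw [integral_smul, show ∫ x in O, D.pressure q x = 0 from hq, smul_zero]

/-- A linear functional which vanishes on `E_{D,0}` is represented by a pressure. -/
theorem exists_meanFree_pressureForm_eq (hp : 1 < p) (hD : D.IsStable Γ) (l : X →ₗ[ℝ] ℝ)
    (hl : ∀ v ∈ D.divFree, l v = 0) : ∃ q, D.MeanFree q ∧ pressureForm hp hD q = l := by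
  obtain ⟨q, hq⟩ := exists_eq_of_forall_eq_zero
    ((pressureForm hp hD).domRestrict (D.meanFreeSubmodule hp)) l fun v hv =>
      hl v ((mem_divFree_iff hp hD).2 fun q hq => hv ⟨q, hq⟩)
  exact ⟨q, q.2, hq⟩

end MeanFree

variable {σ : Space d → Space d}

theorem integrable_inner_transposeMul (hp : 1 < p) (hD : D.IsStable Γ)
    (hσ : MemLp σ ⊤ (volume.restrict O)) (v ξ : X) :
    Integrable (fun x => inner ℝ (transposeMul (σ x) (D.grad v x)) (D.velocity ξ x))
      (volume.restrict O) :=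
  have := ofReal_holderConjugate hp
  integrable_inner_of_memLp (memLp_transposeMul hσ (Lp.memLp (D.grad v))) (hD.memLp_velocity ξ)

/-- The bilinear form `(σᵀ ∇_D v, Π_D ξ)`. -/
def transportForm (hp : 1 < p) (hD : D.IsStable Γ) (hσ : MemLp σ ⊤ (volume.restrict O)) :
    X →ₗ[ℝ] X →ₗ[ℝ] ℝ :=
  LinearMap.mk₂ ℝ
    (fun v ξ => ∫ x in O, inner ℝ (transposeMul (σ x) (D.grad v x)) (D.velocity ξ x))
    (fun v w ξ => by
      rw [← integral_add (integrable_inner_transposeMul hp hD hσ v ξ)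
        (integrable_inner_transposeMul hp hD hσ w ξ)]
      refine integral_congr_ae ?_
      rw [map_add]
      filter_upwards [Lp.coeFn_add (D.grad v) (D.grad w)] with x hx
      rw [hx, Pi.add_apply, transposeMul_add, inner_add_left])
    (fun c v ξ => by
      rw [smul_eq_mul, ← integral_const_mul]
      refine integral_congr_ae ?_
      rw [map_smul]
      filter_upwards [Lp.coeFn_smul c (D.grad v)] with x hx
      rw [hx, Pi.smul_apply, transposeMul_smul, real_inner_smul_left])
    (fun v ξ η => by
      rw [← integral_add (integrable_inner_transposeMul hp hD hσ v ξ)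
        (integrable_inner_transposeMul hp hD hσ v η)]
      refine integral_congr_ae ?_
      rw [map_add]
      filter_upwards [Lp.coeFn_add (D.velocity ξ) (D.velocity η)] with x hx
      rw [hx, Pi.add_apply, inner_add_right])
    (fun c v ξ => by
      rw [smul_eq_mul, ← integral_const_mul]
      refine integral_congr_ae ?_
      rw [map_smul]
      filter_upwards [Lp.coeFn_smul c (D.velocity ξ)] with x hx
      rw [hx, Pi.smul_apply, real_inner_smul_right])

/-- The discrete noise coefficient as a bilinear form. -/
def noiseBilin (hp : 1 < p) (hD : D.IsStable Γ) (hσ : MemLp σ ⊤ (volume.restrict O)) :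
    X →ₗ[ℝ] X →ₗ[ℝ] ℝ :=
  (1 / 2 : ℝ) • (transportForm hp hD hσ - (transportForm hp hD hσ).flip)

theorem noiseBilin_apply (hp : 1 < p) (hD : D.IsStable Γ) (hσ : MemLp σ ⊤ (volume.restrict O))
    (v ξ : X) : noiseBilin hp hD hσ v ξ = D.noiseForm σ v ξ := by
  simp only [noiseBilin, transportForm, noiseForm, LinearMap.smul_apply, LinearMap.sub_apply,
    LinearMap.flip_apply, LinearMap.mk₂_apply, smul_eq_mul, mul_sub]
  simp only [real_inner_comm]

/-- Antisymmetry: the transport noise contributes nothing to the energy balance or to monotonicity.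
-/
theorem noiseBilin_self (hp : 1 < p) (hD : D.IsStable Γ) (hσ : MemLp σ ⊤ (volume.restrict O))
    (v : X) : noiseBilin hp hD hσ v v = 0 := by
  simp [noiseBilin]

/-- The functional `(f, Π_D ξ)` for square integrable `f`. -/
def loadForm (D : GradientDiscretisation O p X Y) {f : Space d → Space d}
    (hf : MemLp f 2 (volume.restrict O)) : X →ₗ[ℝ] ℝ :=
  (innerSL ℝ hf.toLp : VelocityL2 O →ₗ[ℝ] ℝ) ∘ₗ D.velocity

theorem loadForm_apply {f : Space d → Space d} (hf : MemLp f 2 (volume.restrict O)) (ξ : X) :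
    D.loadForm hf ξ = ∫ x in O, inner ℝ (f x) (D.velocity ξ x) := by
  change inner ℝ hf.toLp (D.velocity ξ) = _
  rw [L2.inner_def]
  refine integral_congr_ae ?_
  filter_upwards [hf.coeFn_toLp] with x hx
  rw [hx]

variable [IsFiniteMeasure (volume.restrict O)]

/-- The functional `(S(U), ε_D ξ)`. -/
def stressForm (D : GradientDiscretisation O p X Y) (hp : 1 < p) (hκ : 0 ≤ κ) {U : Space d → Mat d}
    (hU : MemLp U (ENNReal.ofReal p) (volume.restrict O)) : X →ₗ[ℝ] ℝ where
  toFun ξ := ∫ x in O, inner ℝ (stress p κ (U x)) (D.symGrad ξ x)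
  map_add' ξ η := by
    rw [← integral_add (integrable_inner_stress hp hκ hU (Lp.memLp _))
      (integrable_inner_stress hp hκ hU (Lp.memLp _))]
    refine integral_congr_ae ?_
    rw [map_add]
    filter_upwards [Lp.coeFn_add (D.symGrad ξ) (D.symGrad η)] with x hx
    rw [hx, Pi.add_apply, inner_add_right]
  map_smul' c ξ := by
    rw [smul_eq_mul, ← integral_const_mul]
    refine integral_congr_ae ?_
    rw [map_smul]
    filter_upwards [Lp.coeFn_smul c (D.symGrad ξ)] with x hx
    rw [hx, Pi.smul_apply, real_inner_smul_right]
    rfl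

theorem stressForm_apply (hp : 1 < p) (hκ : 0 ≤ κ) {U : Space d → Mat d}
    (hU : MemLp U (ENNReal.ofReal p) (volume.restrict O)) (ξ : X) :
    D.stressForm hp hκ hU ξ = ∫ x in O, inner ℝ (stress p κ (U x)) (D.symGrad ξ x) := rfl

end GradientDiscretisation

/-! ### The Crank--Nicolson resolvent -/

section Resolvent

/-- Young's inequality for `(m r)(t / m)`, with `m` chosen so that `m^p = p δ`. -/
theorem exists_young_const {p q : ℝ} (hpq : p.HolderConjugate q) {δ : ℝ} (hδ : 0 < δ) :
    ∃ C : ℝ, 0 ≤ C ∧ ∀ r t : ℝ, 0 ≤ r → 0 ≤ t → r * t ≤ δ * r ^ p + C * t ^ q := by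
  have hp := hpq.pos
  have hq := hpq.symm.pos
  set m := (p * δ) ^ p⁻¹ with hm
  have hm0 : 0 < m := by positivity
  have hmp : m ^ p = p * δ := Real.rpow_inv_rpow (by positivity) hp.ne'
  refine ⟨(m⁻¹) ^ q / q, by positivity, fun r t hr ht => ?_⟩
  have h := Real.young_inequality_of_nonneg (mul_nonneg hm0.le hr)
    (mul_nonneg (inv_nonneg.2 hm0.le) ht) hpq
  rw [Real.mul_rpow hm0.le hr, Real.mul_rpow (inv_nonneg.2 hm0.le) ht, hmp] at h
  calc r * t = m * r * (m⁻¹ * t) := by field_simp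
    _ ≤ p * δ * r ^ p / p + m⁻¹ ^ q * t ^ q / q := h
    _ = δ * r ^ p + m⁻¹ ^ q / q * t ^ q := by field_simp

variable {V : Type*} [NormedAddCommGroup V] [InnerProductSpace ℝ V]

/-- Pair the equation with `w`: `2(w - v, w)` is the energy difference between `2w - v` and `v`, and
`B` drops out. Taking `δ = τ a / 2` in Young's inequality absorbs `s (b, w)` into half of the
coercive term. -/
theorem exists_energy_const {p q : ℝ} (hpq : p.HolderConjugate q) {τ a C₀ : ℝ} (hτ : 0 < τ)
    (ha : 0 < a) {F : V → V} (hF : ∀ w, a * ‖w‖ ^ p - C₀ ≤ inner ℝ (F w) w) {B : V →ₗ[ℝ] V}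
    (hB : ∀ v, inner ℝ (B v) v = 0) (b : V) :
    ∃ c C : ℝ, 0 < c ∧ 0 ≤ C ∧ ∀ v w s, (2 : ℝ) • (w - v) + τ • F w = s • (B w + b) →
      (‖(2 : ℝ) • w - v‖ ^ 2 - ‖v‖ ^ 2) / 2 + c * ‖w‖ ^ p ≤ C * (1 + |s| ^ q) := by
  obtain ⟨C₁, hC₁, hY⟩ := exists_young_const hpq (δ := τ * a / 2) (by positivity)
  refine ⟨τ * a / 2, max (τ * C₀) (C₁ * ‖b‖ ^ q), by positivity,
    le_max_of_le_right (by positivity), fun v w s h => ?_⟩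
  have h1 : (‖(2 : ℝ) • w - v‖ ^ 2 - ‖v‖ ^ 2) / 2 = 2 * inner ℝ (w - v) w := by
    rw [← real_inner_self_eq_norm_sq, ← real_inner_self_eq_norm_sq]
    simp only [inner_sub_left, inner_sub_right, real_inner_smul_left, real_inner_smul_right,
      real_inner_comm v w]
    ring
  have h2 : 2 * inner ℝ (w - v) w + τ * inner ℝ (F w) w = s * inner ℝ b w := by
    have := congrArg (fun z => inner ℝ z w) h
    simpa [inner_add_left, real_inner_smul_left, hB] using this
  have h3 : s * inner ℝ b w ≤ ‖w‖ * (|s| * ‖b‖) := by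
    calc s * inner ℝ b w ≤ |s * inner ℝ b w| := le_abs_self _
      _ = |s| * |inner ℝ b w| := abs_mul _ _
      _ ≤ |s| * (‖b‖ * ‖w‖) := by gcongr; exact abs_real_inner_le_norm _ _
      _ = ‖w‖ * (|s| * ‖b‖) := by ring
  have h4 := hY ‖w‖ (|s| * ‖b‖) (norm_nonneg _) (by positivity)
  rw [Real.mul_rpow (abs_nonneg _) (norm_nonneg _)] at h4
  have h5 := mul_le_mul_of_nonneg_left (hF w) hτ.le
  have h6 : τ * C₀ + C₁ * ‖b‖ ^ q * |s| ^ q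
      ≤ max (τ * C₀) (C₁ * ‖b‖ ^ q) * (1 + |s| ^ q) := by
    have hs : 0 ≤ |s| ^ q := by positivity
    nlinarith [le_max_left (τ * C₀) (C₁ * ‖b‖ ^ q),
      mul_le_mul_of_nonneg_right (le_max_right (τ * C₀) (C₁ * ‖b‖ ^ q)) hs]
  rw [h1]
  linarith

variable [FiniteDimensional ℝ V]

theorem exists_linearMap_inner_eq (N : V →ₗ[ℝ] V →ₗ[ℝ] ℝ) :
    ∃ B : V →ₗ[ℝ] V, ∀ v w, inner ℝ (B v) w = N v w := by
  choose B hB using fun v => exists_inner_eq (N v)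
  exact ⟨{ toFun := B
           map_add' := fun v w => ext_inner_right ℝ fun z => by simp [inner_add_left, hB]
           map_smul' := fun c v => ext_inner_right ℝ fun z => by
            simp [real_inner_smul_left, hB] }, hB⟩

/-- The identity contributes strong monotonicity with constant 2, `F` helps and `B` is neutral, so
neither `τ` nor `s` has to be small. -/
theorem exists_resolvent {τ : ℝ} (hτ : 0 < τ) {F : V → V} (hF : Continuous F)
    (hmono : ∀ v w, 0 ≤ inner ℝ (F v - F w) (v - w)) (B : V →ₗ[ℝ] V)
    (hB : ∀ v, inner ℝ (B v) v = 0) (b : V) :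
    ∃ R : V × ℝ → V, Continuous R ∧ ∀ v s w,
      (2 : ℝ) • (w - v) + τ • F w = s • (B w + b) ↔ w = R (v, s) := by
  let A : ℝ → V → V := fun s w => (2 : ℝ) • w + τ • F w - s • (B w + b)
  have hBc : Continuous B := B.continuous_of_finiteDimensional
  have hAc : ∀ s, Continuous (A s) := fun s => by fun_prop
  have hAm : ∀ s, StronglyMonotone 2 (A s) := by
    intro s x y
    have h1 : A s x - A s y = (2 : ℝ) • (x - y) + τ • (F x - F y) - s • B (x - y) := by
      simp only [A, map_sub, smul_sub, smul_add]; abel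
    rw [h1, inner_sub_left, inner_add_left, real_inner_smul_left, real_inner_smul_left,
      real_inner_smul_left, hB, real_inner_self_eq_norm_sq]
    nlinarith [mul_nonneg hτ.le (hmono x y)]
  choose R hR using fun z : V × ℝ =>
    (hAm z.2).surjective two_pos (hAc z.2) ((2 : ℝ) • z.1)
  refine ⟨R, ?_, fun v s w => ?_⟩
  · rw [continuous_iff_continuousAt]
    intro z₀
    -- Insert the solution at `z₀` into the operator at `z`: the defect is linear in `z - z₀`, and
    -- strong monotonicity bounds the distance of the solutions by it.
    have hbound : ∀ z, ‖R z - R z₀‖ ≤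
        ‖z.1 - z₀.1‖ + ‖(z.2 - z₀.2) • (B (R z₀) + b)‖ / 2 := by
      intro z
      have h1 := (hAm z.2).mul_norm_sub_le (R z) (R z₀)
      have h2 : A z.2 (R z₀) = (2 : ℝ) • z₀.1 - (z.2 - z₀.2) • (B (R z₀) + b) := by
        rw [← hR z₀]
        simp only [A, sub_smul]; abel
      rw [hR z, h2, sub_sub_eq_add_sub, add_sub_right_comm, ← smul_sub] at h1
      have h3 := h1.trans (norm_add_le _ _)
      rw [norm_smul, Real.norm_of_nonneg zero_le_two] at h3
      linarith
    have hc : Continuous fun z : V × ℝ =>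
        ‖z.1 - z₀.1‖ + ‖(z.2 - z₀.2) • (B (R z₀) + b)‖ / 2 := by fun_prop
    have ht := hc.tendsto z₀
    simp only [sub_self, zero_smul, norm_zero, zero_div, add_zero] at ht
    rw [ContinuousAt, tendsto_iff_norm_sub_tendsto_zero]
    exact squeeze_zero (fun _ => norm_nonneg _) hbound ht
  · have h1 : (2 : ℝ) • (w - v) + τ • F w = s • (B w + b) ↔ A s w = (2 : ℝ) • v := by
      simp only [A, smul_sub]
      constructor <;> intro h
      · rw [← h]; abel
      · rw [← sub_eq_zero] at h ⊢
        rw [← h]; abel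
    rw [h1]
    constructor
    · intro h
      have h2 := (hAm s).mul_norm_sub_le w (R (v, s))
      rw [h, hR (v, s), sub_self, norm_zero] at h2
      exact sub_eq_zero.1 (norm_le_zero_iff.1 (by linarith))
    · rintro rfl
      exact hR (v, s)

end Resolvent

namespace GradientDiscretisation

variable {d : ℕ} {O : Set (Space d)} {p κ : ℝ} {X Y : Type*}
  [AddCommGroup X] [Module ℝ X] [FiniteDimensional ℝ X]
  [AddCommGroup Y] [Module ℝ Y] [FiniteDimensional ℝ Y]
  {D : GradientDiscretisation O p X Y} {Γ : ℝ≥0}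

/-! ### Reduction to the reconstructed divergence-free velocities -/

section Lift

variable (D) (hp : 1 < p) (hD : D.IsStable Γ)

/-- The image `Π_D E_{D,0}` in `𝕃²(O)`. -/
def velocitySpace : Submodule ℝ (VelocityL2 O) :=
  LinearMap.range (D.velocity.domRestrict (divFreeSubmodule hp hD))

/-- The inverse of `Π_D` on `E_{D,0}`. -/
def lift : D.velocitySpace hp hD →ₗ[ℝ] X :=
  (divFreeSubmodule hp hD).subtype ∘ₗ
    (LinearEquiv.ofInjective (D.velocity.domRestrict (divFreeSubmodule hp hD))
      (fun v w h => Subtype.ext (D.velocity_injOn v.2 w.2 h))).symm.toLinearMap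

instance : FiniteDimensional ℝ (D.velocitySpace hp hD) := by
  unfold velocitySpace; infer_instance

theorem velocity_lift (v : D.velocitySpace hp hD) : D.velocity (D.lift hp hD v) = v := by
  have h := (LinearEquiv.ofInjective (D.velocity.domRestrict (divFreeSubmodule hp hD))
    (fun v w h => Subtype.ext (D.velocity_injOn v.2 w.2 h))).apply_symm_apply v
  exact congrArg Subtype.val h

theorem lift_mem_divFree (v : D.velocitySpace hp hD) : D.lift hp hD v ∈ D.divFree :=
  Subtype.property (p := fun x => x ∈ divFreeSubmodule hp hD) _

theorem exists_lift_eq {ξ : X} (hξ : ξ ∈ D.divFree) : ∃ v, D.lift hp hD v = ξ := by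
  refine ⟨⟨D.velocity ξ, ⟨ξ, hξ⟩, rfl⟩, ?_⟩
  exact D.velocity_injOn (D.lift_mem_divFree hp hD _) hξ (D.velocity_lift hp hD _)

end Lift

/-- An inner product space `V` which is identified with `E_{D,0}` through `lift`, in such a way that
`Π_D` is isometric. -/
structure DivFreeModel (D : GradientDiscretisation O p X Y) (V : Type*) [NormedAddCommGroup V]
    [InnerProductSpace ℝ V] where
  lift : V →ₗ[ℝ] X
  emb : V →ₗᵢ[ℝ] VelocityL2 O
  velocity_lift : ∀ v, D.velocity (lift v) = emb v
  lift_mem : ∀ v, lift v ∈ D.divFree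
  exists_lift_eq : ∀ ξ ∈ D.divFree, ∃ v, lift v = ξ

theorem DivFreeModel.lift_injective {V : Type*} [NormedAddCommGroup V] [InnerProductSpace ℝ V]
    (j : DivFreeModel D V) : Function.Injective j.lift := fun v w h => by
  have := congrArg D.velocity h
  rw [j.velocity_lift, j.velocity_lift] at this
  exact j.emb.injective this

/-- The model of `E_{D,0}` on its image in `𝕃²(O)`. -/
def divFreeModel (D : GradientDiscretisation O p X Y) (hp : 1 < p) (hD : D.IsStable Γ) :
    DivFreeModel D (D.velocitySpace hp hD) where
  lift := D.lift hp hD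
  emb := (D.velocitySpace hp hD).subtypeₗᵢ
  velocity_lift := D.velocity_lift hp hD
  lift_mem := D.lift_mem_divFree hp hD
  exists_lift_eq := fun _ hξ => D.exists_lift_eq hp hD hξ

end GradientDiscretisation

/-! ### The Crank--Nicolson step on the divergence-free model space -/

namespace GradientDiscretisation

variable {d : ℕ} {O : Set (Space d)} {p κ : ℝ} {X Y : Type*}
  [AddCommGroup X] [Module ℝ X] [FiniteDimensional ℝ X]
  [AddCommGroup Y] [Module ℝ Y] [FiniteDimensional ℝ Y]
  {D : GradientDiscretisation O p X Y} {Γ : ℝ≥0} [IsFiniteMeasure (volume.restrict O)]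
  {V : Type*} [NormedAddCommGroup V] [InnerProductSpace ℝ V] [FiniteDimensional ℝ V]

/-- `F` is the Riesz representative of the stress functional. Monotonicity and coercivity are
integrated from the pointwise inequalities for `stress`. -/
theorem exists_stressOperator (hp : 1 < p) (hκ : 0 ≤ κ) (J : DivFreeModel D V)
    {G : Space d → Mat d} (hG : MemLp G ⊤ (volume.restrict O)) :
    ∃ F : V → V, Continuous F ∧
      (∀ v w, 0 ≤ inner ℝ (F v - F w) (v - w)) ∧
      (∀ v w, inner ℝ (F v) w = ∫ x in O, inner ℝ
        (stress p κ (D.symGrad (J.lift v) x + G x)) (D.symGrad (J.lift w) x)) ∧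
      ∃ a C₀ : ℝ, 0 < a ∧ ∀ w, a * ‖w‖ ^ p - C₀ ≤ inner ℝ (F w) w := by
  have hp0 : 0 < p := by linarith
  have : Fact (1 ≤ ENNReal.ofReal p) := ⟨by simpa using hp.le⟩
  have hGp : MemLp G (ENNReal.ofReal p) (volume.restrict O) := hG.mono_exponent le_top
  let L : V →ₗ[ℝ] Lp (Mat d) (ENNReal.ofReal p) (volume.restrict O) :=
    D.symGrad ∘ₗ J.lift
  have hU : ∀ v, MemLp (fun x => L v x + G x) (ENNReal.ofReal p) (volume.restrict O) :=
    fun v => (Lp.memLp (L v)).add hGp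
  choose F hF using fun v => exists_inner_eq ((D.stressForm hp hκ (hU v)) ∘ₗ J.lift)
  have hF' : ∀ v w, inner ℝ (F v) w
      = ∫ x in O, inner ℝ (stress p κ (L v x + G x)) (L w x) := hF
  have hint : ∀ v w, Integrable (fun x => inner ℝ (stress p κ (L v x + G x)) (L w x))
      (volume.restrict O) := fun v w => integrable_inner_stress hp hκ (hU v) (Lp.memLp (L w))
  refine ⟨F, continuous_of_continuous_inner fun w => ?_, fun v w => ?_, hF', ?_⟩
  · simp only [hF']
    exact continuous_integral_inner_stress hp hκ L hGp (Lp.memLp (L w))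
  · rw [inner_sub_left, hF', hF', ← integral_sub (hint _ _) (hint _ _)]
    refine integral_nonneg_of_ae ?_
    rw [map_sub]
    filter_upwards [Lp.coeFn_sub (L v) (L w)] with x hx
    have h := stress_monotone hp hκ (L v x + G x) (L w x + G x)
    rw [add_sub_add_right_eq_sub, inner_sub_left] at h
    rw [hx]
    exact h
  · obtain ⟨M, -, hM⟩ := exists_ae_norm_le_of_memLp_top hG
    obtain ⟨C, hC⟩ := exists_norm_rpow_le_inner_stress (d := d) hp hκ M
    have hLinj : Function.Injective L := by
      rw [← LinearMap.ker_eq_bot, LinearMap.ker_eq_bot']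
      intro v hv
      have h0 : J.lift v = 0 := D.symGrad_definite _ (by
        rw [show D.symGrad (J.lift v) = 0 from hv, norm_zero])
      exact J.lift_injective (h0.trans (map_zero _).symm)
    -- An injective linear map on a finite dimensional space is bounded below; this compares the
    -- norm of `V` with the `L^p` norm of the symmetric gradient.
    obtain ⟨K, hK0, hK⟩ := L.exists_antilipschitzWith (LinearMap.ker_eq_bot.2 hLinj)
    have hK' : ∀ v, ‖v‖ ≤ K * ‖L v‖ := fun v => by simpa using hK.le_mul_dist v 0
    have hnorm : ∀ v, ‖L v‖ ^ p = ∫ x in O, ‖L v x‖ ^ p := by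
      intro v
      rw [Lp.norm_def, MemLp.eLpNorm_eq_integral_rpow_norm (by simpa using hp0)
        ENNReal.ofReal_ne_top (Lp.memLp (L v)), ENNReal.toReal_ofReal hp0.le,
        ENNReal.toReal_ofReal (by positivity), Real.rpow_inv_rpow (by positivity) hp0.ne']
    have hmain : ∀ v, ‖L v‖ ^ p
        ≤ 2 ^ p * inner ℝ (F v) v + (volume.restrict O).real Set.univ * C := by
      intro v
      have h1 : Integrable (fun x => 2 ^ p * inner ℝ (stress p κ (L v x + G x)) (L v x) + C)
          (volume.restrict O) := ((hint v v).const_mul _).add (integrable_const C)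
      rw [hnorm, hF', ← integral_const_mul, ← smul_eq_mul ((volume.restrict O).real Set.univ),
        ← integral_const, ← integral_add ((hint v v).const_mul _) (integrable_const C)]
      refine integral_mono_ae
        (integrable_rpow_of_memLp hp (Lp.memLp (L v)).norm fun x => norm_nonneg _) h1 ?_
      filter_upwards [hM] with x hx
      exact hC _ _ hx
    have hK1 : (0 : ℝ) < K := hK0
    refine ⟨(2 ^ p * (K : ℝ) ^ p)⁻¹, (2 ^ p)⁻¹ * ((volume.restrict O).real Set.univ * C),
      by positivity, fun w => ?_⟩
    have h1 : ‖w‖ ^ p ≤ (K : ℝ) ^ p * ‖L w‖ ^ p := by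
      rw [← Real.mul_rpow (by positivity) (by positivity)]
      exact Real.rpow_le_rpow (norm_nonneg _) (hK' w) hp0.le
    have h2 : ((K : ℝ) ^ p)⁻¹ * ‖w‖ ^ p
        ≤ 2 ^ p * inner ℝ (F w) w + (volume.restrict O).real Set.univ * C := by
      rw [inv_mul_le_iff₀ (by positivity)]
      exact h1.trans (by gcongr; exact hmain w)
    have h3 : (0 : ℝ) < 2 ^ p := by positivity
    rw [mul_inv, mul_assoc, ← mul_sub, inv_mul_le_iff₀ h3]
    linarith

/-- The Crank--Nicolson step is solvable, its velocity is given by a continuous resolvent, and it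
satisfies an energy inequality. -/
theorem exists_stepResolvent (hp : 1 < p) (hκ : 0 ≤ κ) (hD : D.IsStable Γ) (J : DivFreeModel D V)
    {g σ : Space d → Space d} (hσ : MemLp σ ⊤ (volume.restrict O))
    (hg : MemLp (weakGrad O g) ⊤ (volume.restrict O)) {τ : ℝ} (hτ : 0 < τ) :
    ∃ R : V × ℝ → V, Continuous R ∧
      (∀ v s q, D.MeanFree q → ∃ s', D.IsStep κ g σ τ s (J.lift v, q) s') ∧
      (∀ v s q s', D.MeanFree q → D.IsStep κ g σ τ s (J.lift v, q) s' →
        s'.1 = J.lift ((2 : ℝ) • R (v, s) - v)) ∧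
      ∃ c C : ℝ, 0 < c ∧ 0 ≤ C ∧ ∀ v s, (‖(2 : ℝ) • R (v, s) - v‖ ^ 2 - ‖v‖ ^ 2) / 2
        + c * ‖R (v, s)‖ ^ p ≤ C * (1 + |s| ^ p.conjExponent) := by
  have hG := memLp_symPart hg
  have hGp : MemLp (fun x => symPart (weakGrad O g x)) (ENNReal.ofReal p)
      (volume.restrict O) := hG.mono_exponent le_top
  obtain ⟨F, hFc, hFm, hF, a, C₀, ha, hFa⟩ := exists_stressOperator hp hκ J hG
  obtain ⟨B, hB⟩ := exists_linearMap_inner_eq ((noiseBilin hp hD hσ).compl₁₂ J.lift J.lift)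
  have hB' : ∀ v w, inner ℝ (B v) w = D.noiseForm σ (J.lift v) (J.lift w) := fun v w => by
    rw [hB, LinearMap.compl₁₂_apply, noiseBilin_apply]
  have hf : MemLp (fun x => transposeMul (σ x) (weakGrad O g x)) 2 (volume.restrict O) :=
    (memLp_transposeMul hσ hg).mono_exponent le_top
  obtain ⟨b, hb⟩ := exists_inner_eq (D.loadForm hf ∘ₗ J.lift)
  have hBself : ∀ v, inner ℝ (B v) v = 0 := fun v => by
    rw [hB, LinearMap.compl₁₂_apply, noiseBilin_self]
  obtain ⟨R, hRc, hR⟩ := exists_resolvent hτ hFc hFm B hBself b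
  obtain ⟨c, C, hc, hC, hen⟩ :=
    exists_energy_const (Real.HolderConjugate.conjExponent hp) hτ ha hFa hBself b
  have hmid : ∀ v w, midpoint (J.lift v) (J.lift ((2 : ℝ) • w - v)) = J.lift w := fun v w => by
    rw [midpoint, ← map_add, sub_add_cancel, ← map_smul, smul_smul]
    norm_num
  -- The residual of the equation in `V` is the residual of the momentum equation without pressure,
  -- tested with divergence-free fields.
  have hweak : ∀ v w z s, inner ℝ ((2 : ℝ) • (w - v) + τ • F w - s • (B w + b)) z
      = inner ℝ (D.velocity (J.lift ((2 : ℝ) • w - v)) - D.velocity (J.lift v))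
          (D.velocity (J.lift z))
        + τ * (∫ x in O, inner ℝ (stress p κ (D.symGrad (J.lift w) x + symPart (weakGrad O g x)))
          (D.symGrad (J.lift z) x))
        - (D.noiseForm σ (J.lift w) (J.lift z) + ∫ x in O, inner ℝ
          (transposeMul (σ x) (weakGrad O g x)) (D.velocity (J.lift z) x)) * s := by
    intro v w z s
    have h1 : (2 : ℝ) • (w - v) = ((2 : ℝ) • w - v) - v := by
      rw [smul_sub, two_smul ℝ v]; abel
    rw [h1, inner_sub_left _ (s • _), inner_add_left, real_inner_smul_left, real_inner_smul_left,
      inner_add_left, hF, hB', hb, LinearMap.comp_apply, loadForm_apply,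
      J.velocity_lift, J.velocity_lift, J.velocity_lift, ← map_sub, J.emb.inner_map_map]
    ring
  refine ⟨R, hRc, fun v s q hq => ?_, fun v s q s' hq hs' => ?_, c, C, hc, hC, fun v s => ?_⟩
  · set w := R (v, s) with hw
    have hU : MemLp (fun x => D.symGrad (J.lift w) x + symPart (weakGrad O g x)) (ENNReal.ofReal p)
        (volume.restrict O) := (Lp.memLp (D.symGrad (J.lift w))).add hGp
    let l : X →ₗ[ℝ] ℝ :=
      (innerSL ℝ (D.velocity (J.lift ((2 : ℝ) • w - v)) - D.velocity (J.lift v)) :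
        VelocityL2 O →ₗ[ℝ] ℝ) ∘ₗ D.velocity + τ • D.stressForm hp hκ hU
        - s • (noiseBilin hp hD hσ (J.lift w) + D.loadForm hf)
    have hl : ∀ ξ, l ξ = inner ℝ (D.velocity (J.lift ((2 : ℝ) • w - v)) - D.velocity (J.lift v))
          (D.velocity ξ)
        + τ * (∫ x in O, inner ℝ (stress p κ (D.symGrad (J.lift w) x + symPart (weakGrad O g x)))
          (D.symGrad ξ x))
        - (D.noiseForm σ (J.lift w) ξ + ∫ x in O, inner ℝ
          (transposeMul (σ x) (weakGrad O g x)) (D.velocity ξ x)) * s := by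
      intro ξ
      rw [mul_comm _ s, ← noiseBilin_apply hp hD hσ, ← loadForm_apply hf,
        ← stressForm_apply hp hκ hU]
      rfl
    -- The residual `l` vanishes on `E_{D,0}` by the equation for `w`, so a mean-free `r` represents
    -- it; `r` is the pressure increment.
    obtain ⟨r, hr, hrl⟩ := exists_meanFree_pressureForm_eq hp hD l fun ξ hξ => by
      obtain ⟨z, rfl⟩ := J.exists_lift_eq _ hξ
      rw [hl, ← hweak, (hR v s w).2 rfl, sub_self, inner_zero_left]
    refine ⟨(J.lift ((2 : ℝ) • w - v), q + r), (D.meanFreeSubmodule hp).add_mem hq hr, fun ξ => ?_,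
      fun q' hq' => ?_⟩
    · change _ - (∫ x in O, (D.pressure (q + r) x - D.pressure q x) * D.div ξ x) = _
      rw [integral_pressure_sub_mul_div hp hD, add_sub_cancel_left, hrl, hl]
      simp only [hmid]
      ring
    · simp only [hmid]
      exact mem_divFree_iff_integral_div_mul.1 (J.lift_mem w) q' hq'
  · have hdiv : midpoint (J.lift v) s'.1 ∈ D.divFree :=
      mem_divFree_iff_integral_div_mul.2 hs'.incompressible
    obtain ⟨w, hw⟩ := J.exists_lift_eq _ hdiv
    have hs1 : s'.1 = J.lift ((2 : ℝ) • w - v) := by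
      rw [map_sub, map_smul, show J.lift w = _ from hw, midpoint, smul_smul]
      norm_num
    have hwR : (2 : ℝ) • (w - v) + τ • F w = s • (B w + b) := by
      rw [← sub_eq_zero]
      refine ext_inner_right ℝ fun z => ?_
      have hm := hs'.momentum (J.lift z)
      -- The increment of two mean-free pressures is orthogonal to divergence-free test fields, so
      -- any solution of the step has a midpoint solving the equation in `V`.
      have hp0 : ∫ x in O, (D.pressure s'.2 x - D.pressure q x) * D.div (J.lift z) x = 0 := by
        rw [integral_pressure_sub_mul_div hp hD]
        exact (mem_divFree_iff hp hD).1 (J.lift_mem z) _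
          ((D.meanFreeSubmodule hp).sub_mem hs'.meanFree hq)
      simp only [← hw, hp0] at hm
      rw [hweak, inner_zero_left, ← hs1]
      linarith
    rw [hs1, (hR v s w).1 hwR]
  · exact hen v _ s ((hR v s _).2 rfl)

/-- The velocity represents `(vin, ·)` on the model space; the remainder vanishes on `E_{D,0}` and
is therefore a pressure functional. -/
theorem exists_isHelmholtz (hp : 1 < p) (hD : D.IsStable Γ) (J : DivFreeModel D V)
    (vin : VelocityL2 O) :
    ∃ s, D.IsHelmholtz vin s := by
  obtain ⟨v, hv⟩ := exists_inner_eq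
    ((innerSL ℝ vin : VelocityL2 O →ₗ[ℝ] ℝ) ∘ₗ J.emb.toLinearMap)
  let l : X →ₗ[ℝ] ℝ := (innerSL ℝ (vin - J.emb v) : VelocityL2 O →ₗ[ℝ] ℝ) ∘ₗ D.velocity
  have hl : ∀ ξ, l ξ = inner ℝ vin (D.velocity ξ) - inner ℝ (J.emb v) (D.velocity ξ) :=
    fun ξ => inner_sub_left vin (J.emb v) (D.velocity ξ)
  obtain ⟨q, hq, hql⟩ := exists_meanFree_pressureForm_eq hp hD l fun ξ hξ => by
    obtain ⟨z, rfl⟩ := J.exists_lift_eq _ hξ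
    rw [hl, J.velocity_lift, J.emb.inner_map_map, hv, sub_eq_zero]
    rfl
  refine ⟨(J.lift v, q), hq, fun ξ => ?_, fun q' hq' => ?_⟩
  · change _ + ∫ x in O, D.pressure q x * D.div ξ x = _
    rw [← pressureForm_apply hp hD, hql, hl, J.velocity_lift]
    ring
  · exact mem_divFree_iff_integral_div_mul.1 (J.lift_mem v) q' hq'

end GradientDiscretisation

/-- The recursion `x_{n+1} = 2 R(x_n, s_n) - x_n`. -/
def crankNicolson {V : Type*} [AddCommGroup V] [Module ℝ V] (R : V × ℝ → V) (x₀ : V)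
    (s : ℕ → ℝ) : ℕ → V
  | 0 => x₀
  | n + 1 => (2 : ℝ) • R (crankNicolson R x₀ s n, s n) - crankNicolson R x₀ s n

/-! ### The algorithm as a recursion in the model space -/

namespace GradientDiscretisation

variable {d : ℕ} {O : Set (Space d)} {p κ : ℝ} {X Y : Type*}
  [AddCommGroup X] [Module ℝ X] [FiniteDimensional ℝ X]
  [AddCommGroup Y] [Module ℝ Y] [FiniteDimensional ℝ Y]
  {D : GradientDiscretisation O p X Y} {Γ : ℝ≥0} [IsFiniteMeasure (volume.restrict O)]
  {V : Type*} [NormedAddCommGroup V] [InnerProductSpace ℝ V] [FiniteDimensional ℝ V]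

/-- The reconstructed midpoint velocities are generated by a continuous recursion in a finite
dimensional space which satisfies an energy inequality. -/
theorem exists_reduced_dynamics (hp : 1 < p) (hκ : 0 ≤ κ) (hD : D.IsStable Γ) (J : DivFreeModel D V)
    {g σ : Space d → Space d} (hσ : MemLp σ ⊤ (volume.restrict O))
    (hg : MemLp (weakGrad O g) ⊤ (volume.restrict O)) {τ : ℝ} (hτ : 0 < τ) (vin : VelocityL2 O) :
    ∃ (R : V × ℝ → V) (x₀ : V),
      Continuous R ∧
      (∀ dW n, D.velocity (midpoint (D.trajectory κ g σ τ vin dW n).1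
        (D.trajectory κ g σ τ vin dW (n + 1)).1) = J.emb (R (crankNicolson R x₀ dW n, dW n))) ∧
      ∃ c C : ℝ, 0 < c ∧ 0 ≤ C ∧ ∀ v s, (‖(2 : ℝ) • R (v, s) - v‖ ^ 2 - ‖v‖ ^ 2) / 2
        + c * ‖R (v, s)‖ ^ p ≤ C * (1 + |s| ^ p.conjExponent) := by
  obtain ⟨R, hRc, hex, huniq, hen⟩ := exists_stepResolvent hp hκ hD J hσ hg hτ
  have h0 := Classical.epsilon_spec (exists_isHelmholtz hp hD J vin)
  obtain ⟨x₀, hx₀⟩ := J.exists_lift_eq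
    (Classical.epsilon (D.IsHelmholtz vin)).1 (mem_divFree_iff_integral_div_mul.2 h0.incompressible)
  -- The velocity of every solution is forced, so the arbitrary selection does not affect it.
  -- Mean-freeness of the pressure is carried along because solvability of the next step requires
  -- it.
  have htraj : ∀ dW n, (D.trajectory κ g σ τ vin dW n).1
      = J.lift (crankNicolson R x₀ dW n) ∧ D.MeanFree (D.trajectory κ g σ τ vin dW n).2 := by
    intro dW n
    induction n with
    | zero => exact ⟨hx₀.symm, h0.meanFree⟩
    | succ n ih =>
      have hstep : D.IsStep κ g σ τ (dW n) (D.trajectory κ g σ τ vin dW n)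
          (D.trajectory κ g σ τ vin dW (n + 1)) := by
        refine Classical.epsilon_spec ?_
        obtain ⟨s', hs'⟩ := hex (crankNicolson R x₀ dW n) (dW n) _ ih.2
        exact ⟨s', by rwa [← ih.1] at hs'⟩
      exact ⟨huniq _ _ (D.trajectory κ g σ τ vin dW n).2 _ ih.2 (by rwa [← ih.1]),
        hstep.meanFree⟩
  refine ⟨R, x₀, hRc, fun dW n => ?_, hen⟩
  rw [(htraj dW n).1, (htraj dW (n + 1)).1, midpoint, ← map_add, ← map_smul, J.velocity_lift,
    crankNicolson, sub_add_cancel, smul_smul]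
  norm_num

end GradientDiscretisation

/-! ### Time averages of the Crank--Nicolson recursion -/

section TimeAverage

variable {V : Type*} [NormedAddCommGroup V] [InnerProductSpace ℝ V]

/-- The energy differences telescope, and the final energy is nonnegative. -/
theorem sum_norm_rpow_crankNicolson_le {p q c C : ℝ} {R : V × ℝ → V} (x₀ : V)
    (hen : ∀ v s, (‖(2 : ℝ) • R (v, s) - v‖ ^ 2 - ‖v‖ ^ 2) / 2 + c * ‖R (v, s)‖ ^ p
      ≤ C * (1 + |s| ^ q)) (s : ℕ → ℝ) (N : ℕ) :
    c * ∑ n ∈ Finset.range N, ‖R (crankNicolson R x₀ s n, s n)‖ ^ p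
      ≤ ‖x₀‖ ^ 2 / 2 + C * ∑ n ∈ Finset.range N, (1 + |s n| ^ q) := by
  have key : ∀ N, ‖crankNicolson R x₀ s N‖ ^ 2 / 2
      + c * ∑ n ∈ Finset.range N, ‖R (crankNicolson R x₀ s n, s n)‖ ^ p
      ≤ ‖x₀‖ ^ 2 / 2 + C * ∑ n ∈ Finset.range N, (1 + |s n| ^ q) := by
    intro N
    induction N with
    | zero => simp [crankNicolson]
    | succ N ih =>
      have h := hen (crankNicolson R x₀ s N) (s N)
      rw [Finset.sum_range_succ, Finset.sum_range_succ, mul_add, mul_add, crankNicolson]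
      linarith
  have := key N
  have h0 : 0 ≤ ‖crankNicolson R x₀ s N‖ ^ 2 / 2 := by positivity
  linarith

variable {Ω : Type*} {mΩ : MeasurableSpace Ω} {P : Measure Ω}

/-- The average of the laws of `w 0, …, w (N - 1)`. -/
def averagedLaw {E : Type*} [MeasurableSpace E] (P : Measure Ω) (w : ℕ → Ω → E) (N : ℕ) :
    Measure E :=
  (N : ℝ≥0∞)⁻¹ • ∑ n ∈ Finset.range N, P.map (w n)

theorem averagedLaw_apply {E : Type*} [MeasurableSpace E] (w : ℕ → Ω → E) (N : ℕ) (A : Set E) :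
    averagedLaw P w N A = (N : ℝ≥0∞)⁻¹ * ∑ n ∈ Finset.range N, P.map (w n) A := by
  rw [averagedLaw, Measure.smul_apply, Measure.finsetSum_apply, smul_eq_mul]

theorem isProbabilityMeasure_averagedLaw {E : Type*} [MeasurableSpace E] [IsProbabilityMeasure P]
    {w : ℕ → Ω → E} (hw : ∀ n, Measurable (w n)) {N : ℕ} (hN : 1 ≤ N) :
    IsProbabilityMeasure (averagedLaw P w N) := by
  refine ⟨?_⟩
  have h : ∀ n, P.map (w n) Set.univ = 1 := fun n => by
    rw [Measure.map_apply (hw n) MeasurableSet.univ, Set.preimage_univ, measure_univ]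
  rw [averagedLaw_apply]
  simp only [h, Finset.sum_const, Finset.card_range, nsmul_eq_mul, mul_one]
  exact ENNReal.inv_mul_cancel (by simp; omega) (ENNReal.natCast_ne_top N)

theorem map_averagedLaw {E E' : Type*} [MeasurableSpace E] [MeasurableSpace E']
    {w : ℕ → Ω → E} (hw : ∀ n, Measurable (w n)) {φ : E → E'} (hφ : Measurable φ) (N : ℕ) :
    (averagedLaw P w N).map φ = averagedLaw P (fun n ω => φ (w n ω)) N := by
  ext A hA
  rw [Measure.map_apply hφ hA, averagedLaw_apply, averagedLaw_apply]
  congr 1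
  refine Finset.sum_congr rfl fun n _ => ?_
  rw [Measure.map_apply (hw n) (hφ hA)]
  exact (Measure.map_apply (hφ.comp (hw n)) hA).symm

/-- Markov's inequality for each law, averaged over `n`. -/
theorem averagedLaw_norm_gt_le {E : Type*} [NormedAddCommGroup E] [MeasurableSpace E]
    [BorelSpace E] {w : ℕ → Ω → E} (hw : ∀ n, Measurable (w n)) {p K : ℝ} (hp : 0 < p)
    {N : ℕ} (hN : 1 ≤ N)
    (hK : ∫⁻ ω, ∑ n ∈ Finset.range N, ENNReal.ofReal (‖w n ω‖ ^ p) ∂P ≤ N * ENNReal.ofReal K)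
    {r : ℝ} (hr : 0 < r) :
    averagedLaw P w N {x | r < ‖x‖} ≤ ENNReal.ofReal (K / r ^ p) := by
  have hrp : 0 < r ^ p := by positivity
  have hmeas : ∀ n, Measurable fun ω => ENNReal.ofReal (‖w n ω‖ ^ p) := fun n =>
    ((hw n).norm.pow_const p).ennreal_ofReal
  have h1 : ∀ n, ENNReal.ofReal (r ^ p) * P.map (w n) {x | r < ‖x‖}
      ≤ ∫⁻ ω, ENNReal.ofReal (‖w n ω‖ ^ p) ∂P := by
    intro n
    rw [Measure.map_apply (hw n) (measurableSet_lt measurable_const measurable_norm)]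
    refine le_trans ?_ (mul_meas_ge_le_lintegral (hmeas n) (ENNReal.ofReal (r ^ p)))
    gcongr
    intro ω hω
    have hω : r < ‖w n ω‖ := hω
    exact ENNReal.ofReal_le_ofReal (Real.rpow_le_rpow hr.le hω.le hp.le)
  have h2 : ENNReal.ofReal (r ^ p) * ∑ n ∈ Finset.range N, P.map (w n) {x | r < ‖x‖}
      ≤ N * ENNReal.ofReal K := by
    rw [Finset.mul_sum]
    refine (Finset.sum_le_sum fun n _ => h1 n).trans ?_
    rwa [← lintegral_finsetSum _ fun n _ => hmeas n]
  have hN0 : (N : ℝ≥0∞) ≠ 0 := by simp; omega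
  rw [averagedLaw_apply, ENNReal.ofReal_div_of_pos hrp,
    ENNReal.le_div_iff_mul_le (Or.inl (by simpa using hrp)) (Or.inl ENNReal.ofReal_ne_top),
    mul_assoc, mul_comm (∑ n ∈ Finset.range N, _)]
  calc _ ≤ (N : ℝ≥0∞)⁻¹ * (N * ENNReal.ofReal K) := by gcongr
    _ = ENNReal.ofReal K := by
      rw [← mul_assoc, ENNReal.inv_mul_cancel hN0 (ENNReal.natCast_ne_top N), one_mul]

/-- The tail bound `K / r^p` is uniform in `N`, and closed balls of a proper space are compact. -/
theorem isTightMeasureSet_averagedLaw {E : Type*} [NormedAddCommGroup E] [ProperSpace E]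
    [MeasurableSpace E] [BorelSpace E] {w : ℕ → Ω → E} (hw : ∀ n, Measurable (w n)) {p K : ℝ}
    (hp : 0 < p) (hK : ∀ N, 1 ≤ N →
      ∫⁻ ω, ∑ n ∈ Finset.range N, ENNReal.ofReal (‖w n ω‖ ^ p) ∂P ≤ N * ENNReal.ofReal K) :
    IsTightMeasureSet {μ | ∃ N : ℕ, 1 ≤ N ∧ μ = averagedLaw P w N} := by
  refine isTightMeasureSet_of_tendsto_measure_norm_gt ?_
  have hlim : Tendsto (fun r : ℝ => ENNReal.ofReal (K / r ^ p)) atTop (𝓝 0) := by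
    rw [← ENNReal.ofReal_zero]
    exact ENNReal.tendsto_ofReal ((tendsto_rpow_atTop hp).const_div_atTop K)
  refine tendsto_of_tendsto_of_tendsto_of_le_of_le' tendsto_const_nhds hlim
    (Eventually.of_forall fun _ => zero_le) ?_
  filter_upwards [eventually_gt_atTop 0] with r hr
  refine iSup₂_le fun μ hμ => ?_
  obtain ⟨N, hN, rfl⟩ := hμ
  exact averagedLaw_norm_gt_le hw hp hN (hK N hN) hr

/-- Sequential form of Prokhorov's theorem. -/
theorem exists_subseq_tendsto_of_isTightMeasureSet {E : Type*} [TopologicalSpace E]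
    [TopologicalSpace.MetrizableSpace E] [TopologicalSpace.SeparableSpace E] [MeasurableSpace E]
    [BorelSpace E] (μ : ℕ → ProbabilityMeasure E)
    (hμ : IsTightMeasureSet (Set.range fun n => (μ n : Measure E))) :
    ∃ (φ : ℕ → ℕ) (ν : ProbabilityMeasure E), StrictMono φ ∧
      Tendsto (fun k => μ (φ k)) atTop (𝓝 ν) := by
  have h : IsCompact (closure (Set.range μ)) := by
    refine isCompact_closure_of_isTightMeasureSet (hμ.subset ?_)
    rintro _ ⟨_, ⟨n, rfl⟩, rfl⟩
    exact ⟨n, rfl⟩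
  obtain ⟨ν, -, φ, hφ, hlim⟩ := h.tendsto_subseq fun n => subset_closure ⟨n, rfl⟩
  exact ⟨φ, ν, hφ, hlim⟩

theorem lintegral_sum_norm_rpow_crankNicolson_le [IsProbabilityMeasure P] {p q c C m : ℝ}
    (hc : 0 < c) (hC : 0 ≤ C) {R : V × ℝ → V} (x₀ : V)
    (hen : ∀ v s, (‖(2 : ℝ) • R (v, s) - v‖ ^ 2 - ‖v‖ ^ 2) / 2 + c * ‖R (v, s)‖ ^ p
      ≤ C * (1 + |s| ^ q)) {S : ℕ → Ω → ℝ} (hSi : ∀ n, Integrable (fun ω => |S n ω| ^ q) P)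
    (hSm : ∀ n, ∫ ω, |S n ω| ^ q ∂P = m) {N : ℕ} (hN : 1 ≤ N) :
    ∫⁻ ω, ∑ n ∈ Finset.range N, ENNReal.ofReal
        (‖R (crankNicolson R x₀ (fun m => S m ω) n, S n ω)‖ ^ p) ∂P
      ≤ N * ENNReal.ofReal (c⁻¹ * (‖x₀‖ ^ 2 / 2 + C * (1 + m))) := by
  have hadd : ∀ n, Integrable (fun ω => 1 + |S n ω| ^ q) P := fun n =>
    (integrable_const 1).add (hSi n)
  have hsum : Integrable (fun ω => C * ∑ n ∈ Finset.range N, (1 + |S n ω| ^ q)) P :=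
    (integrable_finsetSum _ fun n _ => hadd n).const_mul C
  have hint : Integrable (fun ω => c⁻¹ * (‖x₀‖ ^ 2 / 2
      + C * ∑ n ∈ Finset.range N, (1 + |S n ω| ^ q))) P :=
    ((integrable_const (‖x₀‖ ^ 2 / 2)).add hsum).const_mul _
  have hN1 : (1 : ℝ) ≤ N := by exact_mod_cast hN
  calc _ ≤ ∫⁻ ω, ENNReal.ofReal (c⁻¹ * (‖x₀‖ ^ 2 / 2
        + C * ∑ n ∈ Finset.range N, (1 + |S n ω| ^ q))) ∂P := by
        refine lintegral_mono fun ω => ?_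
        rw [← ENNReal.ofReal_sum_of_nonneg fun n _ => by positivity]
        refine ENNReal.ofReal_le_ofReal ?_
        rw [le_inv_mul_iff₀ hc]
        exact sum_norm_rpow_crankNicolson_le x₀ hen (fun m => S m ω) N
    _ = ENNReal.ofReal (c⁻¹ * (‖x₀‖ ^ 2 / 2 + C * (N * (1 + m)))) := by
        rw [← ofReal_integral_eq_lintegral_ofReal hint
          (Eventually.of_forall fun ω => by positivity)]
        congr 1
        rw [integral_const_mul, integral_add (integrable_const _) hsum,
          integral_const_mul, integral_finsetSum _ fun n _ => hadd n]
        simp only [integral_add (integrable_const (1 : ℝ)) (hSi _), hSm, integral_const,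
          probReal_univ, one_smul, Finset.sum_const, Finset.card_range, nsmul_eq_mul]
    -- The initial energy appears once and not `N` times; `1 ≤ N` allows it to be put under the
    -- common factor `N`.
    _ ≤ ENNReal.ofReal (N * (c⁻¹ * (‖x₀‖ ^ 2 / 2 + C * (1 + m)))) := by
        refine ENNReal.ofReal_le_ofReal ?_
        rw [mul_left_comm (N : ℝ)]
        refine mul_le_mul_of_nonneg_left ?_ (inv_nonneg.2 hc.le)
        have h0 : 0 ≤ ‖x₀‖ ^ 2 / 2 := by positivity
        nlinarith [mul_le_mul_of_nonneg_right hN1 h0]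
    _ = _ := by rw [ENNReal.ofReal_mul (by positivity), ENNReal.ofReal_natCast]

variable [MeasurableSpace V] [BorelSpace V] [FiniteDimensional ℝ V]

theorem measurable_crankNicolson {R : V × ℝ → V} (hR : Continuous R) (x₀ : V) {S : ℕ → Ω → ℝ}
    (hS : ∀ n, Measurable (S n)) (n : ℕ) :
    Measurable fun ω => crankNicolson R x₀ (fun m => S m ω) n := by
  have : SecondCountableTopology V :=
    have := FiniteDimensional.proper ℝ V
    secondCountable_of_proper
  induction n with
  | zero => exact measurable_const
  | succ n ih =>
    exact ((hR.measurable.comp (ih.prodMk (hS n))).const_smul (2 : ℝ)).sub ih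

end TimeAverage

/-! ### Increments of the Wiener process -/

section Increments

variable {Ω : Type*} {mΩ : MeasurableSpace Ω} {P : Measure Ω} {ℱ : Filtration ℝ≥0 mΩ}
  {W : ℝ≥0 → Ω → ℝ}

theorem IsWienerProcess.measurable (hW : IsWienerProcess ℱ W P) (t : ℝ≥0) : Measurable (W t) :=
  (hW.adapted t).mono (ℱ.le t) le_rfl

theorem integrable_abs_rpow_gaussianReal (v : ℝ≥0) {q : ℝ} (hq : 0 < q) :
    Integrable (fun x : ℝ => |x| ^ q) (gaussianReal 0 v) := by
  have h := (memLp_id_gaussianReal' (μ := 0) (v := v) (ENNReal.ofReal q)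
    ENNReal.ofReal_ne_top).integrable_norm_rpow (by simpa using hq) ENNReal.ofReal_ne_top
  simpa [ENNReal.toReal_ofReal hq.le] using h

theorem IsWienerProcess.map_increment (hW : IsWienerProcess ℱ W P) (τ : ℝ≥0) (n : ℕ) :
    P.map (fun ω => W ((n + 1 : ℕ) * τ) ω - W (n * τ) ω) = gaussianReal 0 τ := by
  have h := (hW.brownian.toIsPreBrownianReal.hasLaw_sub ((n + 1 : ℕ) * τ) (n * τ)).map_eq
  have hd : nndist (((n + 1 : ℕ) * τ : ℝ≥0) : ℝ) ((n * τ : ℝ≥0) : ℝ) = τ := by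
    ext
    rw [coe_nndist, Real.dist_eq]
    push_cast
    rw [show ((n : ℝ) + 1) * τ - n * τ = τ by ring, abs_of_nonneg τ.coe_nonneg]
  exact h.trans (congrArg (gaussianReal 0) hd)

end Increments

/-! ### Averaged laws of the algorithm as images of laws on the model space -/

namespace GradientDiscretisation

variable {d : ℕ} {O : Set (Space d)} {p κ : ℝ} {X Y : Type*}
  [AddCommGroup X] [Module ℝ X] [FiniteDimensional ℝ X]
  [AddCommGroup Y] [Module ℝ Y] [FiniteDimensional ℝ Y]
  {D : GradientDiscretisation O p X Y} {Γ : ℝ≥0} [IsFiniteMeasure (volume.restrict O)]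
  {V : Type*} [NormedAddCommGroup V] [InnerProductSpace ℝ V] [FiniteDimensional ℝ V]
  [MeasurableSpace V] [BorelSpace V]
  {Ω : Type*} {mΩ : MeasurableSpace Ω} {P : Measure Ω} [IsProbabilityMeasure P]
  {ℱ : Filtration ℝ≥0 mΩ} {W : ℝ≥0 → Ω → ℝ}

/-- The averaged laws of the algorithm are images of averaged laws on a finite dimensional space
which have uniformly bounded moments of order `p`. -/
theorem exists_averagedLawHalf_eq_map (hp : 1 < p) (hκ : 0 ≤ κ) (hD : D.IsStable Γ)
    (J : DivFreeModel D V) {g σ : Space d → Space d} (hσ : MemLp σ ⊤ (volume.restrict O))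
    (hg : MemLp (weakGrad O g) ⊤ (volume.restrict O)) (hW : IsWienerProcess ℱ W P) {τ : ℝ≥0}
    (hτ : 0 < τ) (vin : VelocityL2 O) :
    ∃ w : ℕ → Ω → V, (∀ n, Measurable (w n)) ∧
      (∀ N, D.averagedLawHalf κ g σ τ W P N vin = (averagedLaw P w N).map J.emb) ∧
      IsTightMeasureSet {μ | ∃ N : ℕ, 1 ≤ N ∧ μ = averagedLaw P w N} := by
  obtain ⟨R, x₀, hRc, htraj, c, C, hc, hC, hen⟩ :=
    exists_reduced_dynamics hp hκ hD J hσ hg (NNReal.coe_pos.2 hτ) vin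
  have hq : 0 < p.conjExponent := (Real.HolderConjugate.conjExponent hp).symm.pos
  have : ProperSpace V := FiniteDimensional.proper ℝ V
  have : SecondCountableTopology V := secondCountable_of_proper
  let S : ℕ → Ω → ℝ := fun n ω => W ((n + 1 : ℕ) * τ) ω - W (n * τ) ω
  have hS : ∀ n, Measurable (S n) := fun n => (hW.measurable _).sub (hW.measurable _)
  have hmap : ∀ n, P.map (S n) = gaussianReal 0 τ := hW.map_increment τ
  have hpow : AEStronglyMeasurable (fun x : ℝ => |x| ^ p.conjExponent) (gaussianReal 0 τ) :=
    (integrable_abs_rpow_gaussianReal τ hq).aestronglyMeasurable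
  have hSi : ∀ n, Integrable (fun ω => |S n ω| ^ p.conjExponent) P := fun n =>
    (integrable_map_measure (g := fun x : ℝ => |x| ^ p.conjExponent) (by rwa [hmap n])
      (hS n).aemeasurable).1 (by rw [hmap n]; exact integrable_abs_rpow_gaussianReal τ hq)
  -- All increments have the same centred Gaussian law of variance `τ`, so this moment does not
  -- depend on `n` and the final bound is uniform in `N`.
  have hSm : ∀ n, ∫ ω, |S n ω| ^ p.conjExponent ∂P
      = ∫ x, |x| ^ p.conjExponent ∂(gaussianReal 0 τ) := fun n => by
    rw [← hmap n, integral_map (hS n).aemeasurable (by rwa [hmap n])]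
  have hw : ∀ n, Measurable fun ω => R (crankNicolson R x₀ (fun m => S m ω) n, S n ω) := fun n =>
    hRc.measurable.comp ((measurable_crankNicolson hRc x₀ hS n).prodMk (hS n))
  refine ⟨fun n ω => R (crankNicolson R x₀ (fun m => S m ω) n, S n ω), hw, fun N => ?_,
    isTightMeasureSet_averagedLaw hw (by linarith : 0 < p) fun N hN =>
      lintegral_sum_norm_rpow_crankNicolson_le hc hC x₀ hen hSi hSm hN⟩
  rw [map_averagedLaw hw J.emb.continuous.measurable, averagedLawHalf, averagedLaw]
  congr 1
  refine Finset.sum_congr rfl fun n _ => ?_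
  congr 1
  funext ω
  exact htraj (fun m => S m ω) n

end GradientDiscretisation

end GenStokes

end

/-! ### Transport to `𝕃²(O)` and conclusion -/

theorem lemma4p7 {d : ℕ} (hd : 0 < d)
    (O : Set (GenStokes.Space d)) (hO : GenStokes.IsPolygonalDomain O)
    (p : ℝ) (hp : 1 < p) (κ : ℝ) (hκ : 0 ≤ κ)
    (g σ : GenStokes.Space d → GenStokes.Space d)
    (hg : GenStokes.MemSobolevDiv O 2 ⊤ g) (hσ : GenStokes.MemSobolevDiv O 1 ⊤ σ)
    {X Y : Type*} [AddCommGroup X] [Module ℝ X] [FiniteDimensional ℝ X]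
    [AddCommGroup Y] [Module ℝ Y] [FiniteDimensional ℝ Y]
    (D : GenStokes.GradientDiscretisation O p X Y)
    (Γ : ℝ≥0) (hΓ : 1 ≤ Γ) (hD : D.IsStable Γ)
    {Ω : Type*} {mΩ : MeasurableSpace Ω} (P : Measure Ω) [IsProbabilityMeasure P]
    (ℱ : Filtration ℝ≥0 mΩ) (W : ℝ≥0 → Ω → ℝ) (hW : GenStokes.IsWienerProcess ℱ W P)
    (τ : ℝ≥0) (hτ : 0 < τ) (vin : GenStokes.VelocityL2 O) :
    (∀ N : ℕ, 1 ≤ N → IsProbabilityMeasure (D.averagedLawHalf κ g σ τ W P N vin)) ∧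
    IsTightMeasureSet {μ | ∃ N : ℕ, 1 ≤ N ∧ μ = D.averagedLawHalf κ g σ τ W P N vin} ∧
    ∃ N : ℕ → ℕ, StrictMono N ∧ (∀ k, 1 ≤ N k) ∧
      ∃ μ : Measure (GenStokes.VelocityL2 O), IsProbabilityMeasure μ ∧
        ∀ f : GenStokes.VelocityL2 O →ᵇ ℝ,
          Tendsto (fun k => ∫ v, f v ∂(D.averagedLawHalf κ g σ τ W P (N k) vin)) atTop
            (𝓝 (∫ v, f v ∂μ)) := by
  have := hO.isFiniteMeasure
  let J := D.divFreeModel hp hD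
  have hemb : Continuous J.emb := J.emb.continuous
  obtain ⟨w, hw, hmap, htight⟩ := GenStokes.GradientDiscretisation.exists_averagedLawHalf_eq_map
    hp hκ hD J hσ.1.memLp (hg.1.memLp_weakGrad hO.isOpen) hW hτ vin
  have hprob : ∀ N : ℕ, 1 ≤ N → IsProbabilityMeasure (GenStokes.averagedLaw P w N) :=
    fun N hN => GenStokes.isProbabilityMeasure_averagedLaw hw hN
  refine ⟨fun N hN => ?_, ?_, ?_⟩
  · have := hprob N hN
    rw [hmap]
    exact Measure.isProbabilityMeasure_map hemb.aemeasurable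
  · refine (htight.map hemb).subset ?_
    rintro _ ⟨N, hN, rfl⟩
    exact ⟨_, ⟨N, hN, rfl⟩, (hmap N).symm⟩
  -- Prokhorov is applied in the model space. The index is shifted by one because the average over
  -- `N = 0` terms is the zero measure.
  · obtain ⟨φ, ν, hφ, hlim⟩ := GenStokes.exists_subseq_tendsto_of_isTightMeasureSet
      (fun n => ⟨GenStokes.averagedLaw P w (n + 1), hprob _ (Nat.succ_pos n)⟩)
      (htight.subset (by
        rintro _ ⟨n, rfl⟩
        exact ⟨n + 1, Nat.succ_pos n, rfl⟩))
    refine ⟨fun k => φ k + 1, fun a b hab => Nat.succ_lt_succ (hφ hab), fun k => Nat.succ_pos _,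
      (ν : Measure _).map J.emb, Measure.isProbabilityMeasure_map hemb.aemeasurable, fun f => ?_⟩
    -- A bounded continuous function on `𝕃²(O)` restricts along the embedding to one on the model
    -- space, so weak convergence passes to the image measures.
    have h := ProbabilityMeasure.tendsto_iff_forall_integral_tendsto.1 hlim
      (f.compContinuous ⟨J.emb, hemb⟩)
    have hint : ∀ μ : Measure (D.velocitySpace hp hD),
        ∫ v, f v ∂(μ.map J.emb) = ∫ v, f (J.emb v) ∂μ := fun μ =>
      integral_map hemb.aemeasurable f.continuous.aestronglyMeasurable
    simp only [hmap, hint]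
    exact h
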